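/- **Setting.** Let $k$ be an algebraically closed field and $\Lambda=kQ/I$ a gentle algebra: $Q$ is a finite quiver, at most two arrows start and at most two arrows end at each vertex, $I$ is an admissible ideal generated by paths of length two, and for each arrow $a$ there is at most one arrow $b$ with $ba$ a path not in $I$, at most one $c$ with $ac$ a path not in $I$, at most one $b$ with $ba$ a path in $I$, and at most one $c$ with $ac$ a path in $I$. An arrow $a$ goes from $s(a)$ to $e(a)$; paths are read from right to left; modules are left modules; $P(x)=\Lambda e_x$; maps are composed from left to right, and a path $p\in e_x\Lambda e_y$ also denotes the map $P(x)\to P(y)$, $z\mapsto zp$. **Letters and bands.** A *direct homotopy letter* is a nontrivial path $p$ of $Q$ not lying in $I$; an *inverse* one is a formal inverse $\bar p$ of such a path, with $s(\bar p)=e(p)$, $e(\bar p)=s(p)$. Call a word $w=w_n\cdots w_1$ ($n\ge 1$) of homotopy letters a *cyclic homotopy string* if, for each $i\in\mathbb Z/n$, $s(w_{i+1})=e(w_i)$, the letters $w_{i+1},w_i$ either have the same direction and the two arrows meeting there compose to an element of $I$, or have opposite directions and the two arrows meeting there do not cancel; and $w$ has as many direct as inverse letters. It is a *homotopy band* if moreover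 it is not a power $\rho^m$ with $m>1$. **Band complexes.** For a cyclic homotopy string $w$ and $\lambda\in k^*$, the complex $B^\bullet_{w,\lambda}$ is the direct sum of the $P(e(w_i))$, $i\in\mathbb Z/n$; the differential has for each direct letter $w_i=p$ the component $p\colon P(e(w_i))\to P(s(w_i))$, and for each inverse letter $w_i=\bar p$ the component $p\colon P(s(w_i))\to P(e(w_i))$ (where $P(s(w_i))$ is the summand $P(e(w_{i-1}))$ with index $i-1$), and the component of one chosen direct letter is multiplied by $\lambda$. Degrees are such that these components have degree $1$; this fixes the complex up to shift. **Proposition.** Let $\sigma=\beta\sigma_L\sigma_R\alpha$ and $\tau=\delta\tau_L\tau_R\gamma$ be homotopy bands ($\sigma_L,\sigma_R,\tau_L,\tau_R$ homotopy letters; $\alpha,\beta,\gamma,\delta$ possibly empty words of letters), $\lambda,\mu\in k^*$, and let $f^\bullet\colon B^\bullet_{\sigma,\lambda}\to B^\bullet_{\tau,\mu}$ be a singleton single map with single component $f$, for which $\sigma$ and $\tau$ are compatibly oriented. That is: $f$ is a nontrivial path not in $I$; the only nonzero component of $f^\bullet$ is $f$, from the summand of $B^\bullet_{\sigma,\lambda}$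 at the node between $\sigma_L$ and $\sigma_R$ to the summand of $B^\bullet_{\tau,\mu}$ at the node between $\tau_L$ and $\tau_R$, these having the same degree; $\sigma_R=ff_R$ and $\tau_R=\bar f\,\bar f_L$ with $f_L,f_R$ nontrivial paths; $\sigma_Lf=0$ if $\sigma_L$ is direct, and $f\bar\tau_L=0$ if $\tau_L$ is inverse. Put $$c=\beta\,\sigma_L\,f\,\overline{\tau_L}\,\overline{\delta}\,\overline{\gamma}\,\overline{\tau_R}\,\overline{f}\,\sigma_R\,\alpha ,\qquad\text{where }\ \overline{\tau_R}\,\overline f\,\sigma_R=f_Lff_R\ \text{ is a single direct letter.}$$ Then $c$ is a cyclic homotopy string, hence a homotopy band unless it is a proper power, and the mapping cone $M^\bullet_{f^\bullet}$ is isomorphic, as a complex and hence in the homotopy category, to $B^\bullet_{c,-\lambda\mu^{-1}}$, with the scalar $-\lambda\mu^{-1}$ placed on an arbitrary direct homotopy letter of $c$, and with the node at the left end of $c$ in the degree of the left end of $\sigma$ minus one. (If $c$ is a proper power, $B^\bullet_{c,-\lambda\mu^{-1}}$ denotes the complex given by the same construction.) -/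

import Mathlib

open CategoryTheory

noncomputable section

namespace SingleMapCone

universe u v w

/-! ### Gentle bound quivers and their algebras

`Quiver.Total Q` is Mathlib's type of all arrows of the quiver `Q`; an arrow `a` starts at
`s(a) = a.left` and ends at `e(a) = a.right`. Left modules are used, so paths are read from right
to left: the path `a_n ⋯ a_1` with `s(a_{i+1}) = e(a_i)` is the list `[a_n, …, a_1]`.
A relation `R b a` says that the path `b a` of length two is a generator of the ideal `I`. -/

/-- The path algebra of a quiver with monomial relations of length two, `k Q / I`, presented by
generators (trivial paths `e_x` and arrows) and relations. -/
inductive AlgRel (k : Type w) [Field k] {Q : Type u} [Quiver.{v} Q] [Fintype Q]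
    (R : Quiver.Total Q → Quiver.Total Q → Prop) :
    FreeAlgebra k (Q ⊕ Quiver.Total Q) → FreeAlgebra k (Q ⊕ Quiver.Total Q) → Prop
  | idem (x : Q) : AlgRel k R
      (FreeAlgebra.ι k (Sum.inl x) * FreeAlgebra.ι k (Sum.inl x)) (FreeAlgebra.ι k (Sum.inl x))
  | orth (x y : Q) (h : x ≠ y) : AlgRel k R
      (FreeAlgebra.ι k (Sum.inl x) * FreeAlgebra.ι k (Sum.inl y)) 0
  | sum_one : AlgRel k R (∑ x : Q, FreeAlgebra.ι k (Sum.inl x)) 1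
  | end_mul (a : Quiver.Total Q) : AlgRel k R
      (FreeAlgebra.ι k (Sum.inl a.right) * FreeAlgebra.ι k (Sum.inr a))
      (FreeAlgebra.ι k (Sum.inr a))
  | mul_start (a : Quiver.Total Q) : AlgRel k R
      (FreeAlgebra.ι k (Sum.inr a) * FreeAlgebra.ι k (Sum.inl a.left))
      (FreeAlgebra.ι k (Sum.inr a))
  | zero (b a : Quiver.Total Q) (h : R b a) : AlgRel k R
      (FreeAlgebra.ι k (Sum.inr b) * FreeAlgebra.ι k (Sum.inr a)) 0

/-- The algebra `Λ = k Q / I`. -/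
abbrev Alg (k : Type w) [Field k] {Q : Type u} [Quiver.{v} Q] [Fintype Q]
    (R : Quiver.Total Q → Quiver.Total Q → Prop) : Type (max u v w) :=
  RingQuot (AlgRel k R)

section Algebra

variable (k : Type w) [Field k] {Q : Type u} [Quiver.{v} Q] [Fintype Q]
  (R : Quiver.Total Q → Quiver.Total Q → Prop)

/-- The idempotent `e_x` of `Λ`. -/
def vtx (x : Q) : Alg k R :=
  RingQuot.mkAlgHom k (AlgRel k R) (FreeAlgebra.ι k (Sum.inl x))

/-- The class of an arrow in `Λ`. -/
def arr (a : Quiver.Total Q) : Alg k R :=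
  RingQuot.mkAlgHom k (AlgRel k R) (FreeAlgebra.ι k (Sum.inr a))

/-- The class of a nontrivial path `a_n ⋯ a_1` in `Λ`. -/
def pathElem (p : List (Quiver.Total Q)) : Alg k R :=
  (p.map (arr k R)).prod

/-- The indecomposable projective left module `P(x) = Λ e_x`. -/
def proj (x : Q) : Submodule (Alg k R) (Alg k R) :=
  Submodule.span (Alg k R) {vtx k R x}

end Algebra

section Words

variable {Q : Type u} [Quiver.{v} Q]

/-- `p` is a nontrivial path in `(Q, I)`: a nonempty composable list of arrows which contains no
relation. -/
def IsPath (R : Quiver.Total Q → Quiver.Total Q → Prop) (p : List (Quiver.Total Q)) : Prop :=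
  p ≠ [] ∧ p.IsChain fun b a => b.left = a.right ∧ ¬ R b a

/-- `(Q, I)` is a gentle bound quiver, where `I` is generated by the paths `b a` with `R b a`. -/
structure IsGentle (R : Quiver.Total Q → Quiver.Total Q → Prop) : Prop where
  /-- the relations are paths of length two -/
  composable : ∀ b a, R b a → b.left = a.right
  starting : ∀ x : Q, {a : Quiver.Total Q | a.left = x}.encard ≤ 2
  ending : ∀ x : Q, {a : Quiver.Total Q | a.right = x}.encard ≤ 2
  nonzero_left : ∀ a, {b : Quiver.Total Q | b.left = a.right ∧ ¬ R b a}.Subsingleton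
  nonzero_right : ∀ a, {c : Quiver.Total Q | a.left = c.right ∧ ¬ R a c}.Subsingleton
  zero_left : ∀ a, {b : Quiver.Total Q | b.left = a.right ∧ R b a}.Subsingleton
  zero_right : ∀ a, {c : Quiver.Total Q | a.left = c.right ∧ R a c}.Subsingleton
  /-- `I` contains all sufficiently long paths, i.e. `I` is admissible -/
  admissible : ∃ N : ℕ, ∀ p, IsPath R p → p.length < N

/-- A homotopy letter: a nontrivial path `p` (direct) or its formal inverse `p̄` (inverse). -/
inductive Letter (Q : Type u) [Quiver.{v} Q] : Type (max u v)
  | direct (p : List (Quiver.Total Q))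
  | inverse (p : List (Quiver.Total Q))

namespace Letter

/-- The underlying path of a letter. -/
def path : Letter Q → List (Quiver.Total Q)
  | direct p => p
  | inverse p => p

/-- The inverse letter. -/
def bar : Letter Q → Letter Q
  | direct p => inverse p
  | inverse p => direct p

def isDirect : Letter Q → Bool
  | direct _ => true
  | inverse _ => false

/-- The change of cohomological degree from the left end to the right end of a letter. -/
def sgn : Letter Q → ℤ
  | direct _ => 1
  | inverse _ => -1

/-- The left end `e(l)` of a letter `l`. -/
def leftEnd : (l : Letter Q) → l.path ≠ [] → Q
  | direct p, h => (p.head h).right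
  | inverse p, h => (p.getLast h).left

/-- `Junction R l l'`: the letters `l l'` can stand next to each other, `l` to the left of `l'`, in
a homotopy string. They meet at a vertex; if they point in the same direction then
the two arrows at the junction form a relation, and otherwise they do not cancel. -/
def Junction (R : Quiver.Total Q → Quiver.Total Q → Prop) : Letter Q → Letter Q → Prop
  | direct p, direct q => ∃ b ∈ p.getLast?, ∃ a ∈ q.head?, b.left = a.right ∧ R b a
  | direct p, inverse q => ∃ b ∈ p.getLast?, ∃ a ∈ q.getLast?, b.left = a.left ∧ b ≠ a
  | inverse p, direct q => ∃ b ∈ p.head?, ∃ a ∈ q.head?, b.right = a.right ∧ b ≠ a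
  | inverse p, inverse q => ∃ a ∈ p.head?, ∃ b ∈ q.getLast?, b.left = a.right ∧ R b a

end Letter

/-- The inverse of a word of letters. -/
def barWord (w : List (Letter Q)) : List (Letter Q) :=
  (w.map Letter.bar).reverse

/-- The cyclic successor of a position. -/
def nxt {n : ℕ} (i : Fin n) : Fin n :=
  ⟨(i.1 + 1) % n, Nat.mod_lt _ (Nat.lt_of_le_of_lt (Nat.zero_le _) i.2)⟩

/-- A word `w = σ_n ⋯ σ_1` of homotopy letters (listed as `[σ_n, …, σ_1]`) which can be read
cyclically: every `σ_{i+1} σ_i`, and also `σ_1 σ_n`, is a junction in a homotopy string, and `w` has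
equal numbers of direct and inverse letters. -/
structure IsCyclicString (R : Quiver.Total Q → Quiver.Total Q → Prop) (w : List (Letter Q)) :
    Prop where
  ne_nil : w ≠ []
  isPath : ∀ l ∈ w, IsPath R l.path
  junction : ∀ i : Fin w.length, Letter.Junction R (w.get i) (w.get (nxt i))
  balanced : w.countP (fun l => l.isDirect) = w.countP (fun l => !l.isDirect)

/-- `w = ρ^m` for some word `ρ` and some `m > 1`. -/
def IsProperPower (w : List (Letter Q)) : Prop :=
  ∃ (ρ : List (Letter Q)) (m : ℕ), 1 < m ∧ w = (List.replicate m ρ).flatten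

/-- A homotopy band, as a word of homotopy letters. -/
structure IsHomotopyBand (R : Quiver.Total Q → Quiver.Total Q → Prop) (w : List (Letter Q)) :
    Prop extends IsCyclicString R w where
  primitive : ¬ IsProperPower w

/-- The cohomological degree of the node to the left of the `i`-th letter, where the leftmost
node has degree `d`. -/
def nodeDeg (w : List (Letter Q)) (d : ℤ) (i : ℕ) : ℤ :=
  d + ((w.take i).map Letter.sgn).sum

/-- The vertex of the node to the left of position `i` of `w`. -/
def nodeVtx {R : Quiver.Total Q → Quiver.Total Q → Prop} {w : List (Letter Q)} (hw : IsCyclicString R w) (i : Fin w.length) :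
    Q :=
  (w.get i).leftEnd (hw.isPath _ (List.get_mem w i)).1

theorem nodeVtx_nxt {R : Quiver.Total Q → Quiver.Total Q → Prop} {w : List (Letter Q)} (hw : IsCyclicString R w) (i : Fin w.length)
    (p : List (Quiver.Total Q)) (hp : w.get i = .direct p) (h : p ≠ []) :
    nodeVtx hw (nxt i) = (p.getLast h).left := by
  have hj := hw.junction i
  have key : ∀ (l : Letter Q) (hl : l.path ≠ []), Letter.Junction R (.direct p) l →
      l.leftEnd hl = (p.getLast h).left := by
    intro l hl hJ
    cases l with
    | direct q =>
      obtain ⟨b, hb, a, ha, e, -⟩ := hJ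
      rw [List.getLast?_eq_some_getLast h] at hb
      rw [List.head?_eq_some_head (show q ≠ [] from hl)] at ha
      obtain rfl := Option.some.inj hb
      obtain rfl := Option.some.inj ha
      exact e.symm
    | inverse q =>
      obtain ⟨b, hb, a, ha, e, -⟩ := hJ
      rw [List.getLast?_eq_some_getLast h] at hb
      rw [List.getLast?_eq_some_getLast (show q ≠ [] from hl)] at ha
      obtain rfl := Option.some.inj hb
      obtain rfl := Option.some.inj ha
      exact e.symm
  exact key _ _ (hp ▸ hj)

theorem nodeDeg_nxt {R : Quiver.Total Q → Quiver.Total Q → Prop} {w : List (Letter Q)} (hw : IsCyclicString R w) (d : ℤ) (i : Fin w.length) :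
    nodeDeg w d (nxt i) = nodeDeg w d i + (w.get i).sgn := by
  have hs : ∀ v : List (Letter Q), (v.map Letter.sgn).sum =
      (v.countP (fun l => l.isDirect) : ℤ) - v.countP (fun l => !l.isDirect) := by
    intro v
    induction v with
    | nil => simp
    | cons l v ih =>
      cases l <;> simp [ih, Letter.sgn, Letter.isDirect] <;> ring
  have h0 : (w.map Letter.sgn).sum = 0 := by
    rw [hs, hw.balanced, sub_self]
  have h1 : ((w.take (i + 1)).map Letter.sgn).sum =
      ((w.take i).map Letter.sgn).sum + (w.get i).sgn := by
    rw [List.take_add_one, List.getElem?_eq_getElem i.2]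
    simp
  unfold nodeDeg nxt
  rcases Nat.lt_or_ge (i.1 + 1) w.length with h | h
  · simp only [Nat.mod_eq_of_lt h]
    rw [h1]; ring
  · have e : i.1 + 1 = w.length := le_antisymm i.2 h
    have h2 : ((w.take (i + 1)).map Letter.sgn).sum = 0 := by
      rw [e, List.take_length, h0]
    simp only [e, Nat.mod_self, List.take_zero, List.map_nil, List.sum_nil]
    rw [add_assoc, ← h1, h2]

theorem nxt_injective {n : ℕ} : Function.Injective (nxt : Fin n → Fin n) := by
  intro i j h
  have h' : (i.1 + 1) % n = (j.1 + 1) % n := congrArg Fin.val h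
  have := Nat.ModEq.add_right_cancel' 1 (show i.1 + 1 ≡ j.1 + 1 [MOD n] from h')
  exact Fin.ext (Nat.ModEq.eq_of_lt_of_lt this i.2 j.2)

end Words

/-! ### Band complexes -/

section Band

variable (k : Type w) [Field k] {Q : Type u} [Quiver.{v} Q] [Fintype Q]
  {R : Quiver.Total Q → Quiver.Total Q → Prop}

/-- The module in degree `n` of a band complex: the direct sum of the `P(x_i)` over all nodes `i` of
degree `n`, written as the row vectors `z` with `z i ∈ P(x_i)` for these `i` and `z i = 0` for all
others. -/
def bandX {w : List (Letter Q)} (hw : IsCyclicString R w) (d n : ℤ) :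
    Submodule (Alg k R) (Fin w.length → Alg k R) :=
  Submodule.pi Set.univ fun i => if nodeDeg w d i = n then proj k R (nodeVtx hw i) else ⊥

variable (R) in
/-- The matrix entry coming from the `i`-th letter `l` of `w`: a direct letter `p` gives the map
right multiplication by `p` from the node to the left of `l` to the node to its right, an inverse
letter `p̄` gives right multiplication by `p` in the other direction. The letter at position `m`
carries the scalar `lam`. -/
def letterMatrix (w : List (Letter Q)) (lam : k) (m : Fin w.length) (i : Fin w.length) :
    Matrix (Fin w.length) (Fin w.length) (Alg k R) :=
  match w.get i with
  | .direct p => Matrix.single i (nxt i) ((if i = m then lam else 1) • pathElem k R p)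
  | .inverse p => Matrix.single (nxt i) i ((if i = m then lam else 1) • pathElem k R p)

variable (R) in
/-- The differential of a band complex, acting on row vectors from the right. -/
def bandMatrix (w : List (Letter Q)) (lam : k) (m : Fin w.length) :
    Matrix (Fin w.length) (Fin w.length) (Alg k R) :=
  ∑ i, letterMatrix k R w lam m i


theorem arr_mul_vtx (a : Quiver.Total Q) : arr k R a * vtx k R a.left = arr k R a := by
  unfold arr vtx
  rw [← map_mul]
  exact RingQuot.mkAlgHom_rel k (AlgRel.mul_start a)

theorem arr_mul_arr (b a : Quiver.Total Q) (h : R b a) : arr k R b * arr k R a = 0 := by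
  unfold arr
  rw [← map_mul, RingQuot.mkAlgHom_rel k (AlgRel.zero b a h), map_zero]

theorem pathElem_mul_vtx (p : List (Quiver.Total Q)) (h : p ≠ []) :
    pathElem k R p * vtx k R (p.getLast h).left = pathElem k R p := by
  have e : pathElem k R p = pathElem k R p.dropLast * arr k R (p.getLast h) := by
    conv_lhs => rw [← List.dropLast_append_getLast h]
    simp [pathElem]
  rw [e, mul_assoc, arr_mul_vtx]

theorem pathElem_mul_pathElem (p q : List (Quiver.Total Q)) (b a : Quiver.Total Q)
    (hb : b ∈ p.getLast?) (ha : a ∈ q.head?) (h : R b a) :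
    pathElem k R p * pathElem k R q = 0 := by
  obtain ⟨p', rfl⟩ := List.mem_getLast?_eq_getLast hb |> fun ⟨hp, e⟩ =>
    (⟨p.dropLast, by rw [e, List.dropLast_append_getLast hp]⟩ : ∃ p', p = p' ++ [b])
  cases q with
  | nil => simp at ha
  | cons c q =>
    obtain rfl : c = a := by simpa using ha
    simp only [pathElem, List.map_append, List.prod_append, List.map_cons, List.map_nil,
      List.prod_cons, List.prod_nil, mul_one]
    rw [mul_assoc, ← mul_assoc (arr k R b), arr_mul_arr k b c h, zero_mul, mul_zero]

theorem mul_mem_proj (z : Alg k R) (c : k) (p : List (Quiver.Total Q)) (h : p ≠ []) :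
    z * (c • pathElem k R p) ∈ proj k R (p.getLast h).left := by
  refine Submodule.mem_span_singleton.2 ⟨z * (c • pathElem k R p), ?_⟩
  rw [smul_eq_mul, mul_assoc, smul_mul_assoc, pathElem_mul_vtx]

theorem letterMatrix_mul {w : List (Letter Q)} (hw : IsCyclicString R w) (lam : k)
    (m i j : Fin w.length) :
    letterMatrix k R w lam m i * letterMatrix k R w lam m j = 0 := by
  have hj1 := hw.junction i
  have hj2 := hw.junction j
  unfold letterMatrix
  generalize hi : w.get i = li
  generalize hj : w.get j = lj
  cases li with
  | direct p =>
    cases lj with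
    | direct q =>
      dsimp only
      by_cases e : nxt i = j
      · subst e
        rw [hi, hj] at hj1
        obtain ⟨b, hb, a, ha, -, hR⟩ := hj1
        simp [pathElem_mul_pathElem k p q b a hb ha hR]
      · exact Matrix.single_mul_single_of_ne _ _ _ _ e _
    | inverse q =>
      dsimp only
      by_cases e : nxt i = nxt j
      · have := nxt_injective e
        subst this
        rw [hi] at hj
        cases hj
      · exact Matrix.single_mul_single_of_ne _ _ _ _ e _
  | inverse p =>
    cases lj with
    | direct q =>
      dsimp only
      by_cases e : i = j
      · subst e
        rw [hi] at hj
        cases hj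
      · exact Matrix.single_mul_single_of_ne _ _ _ _ e _
    | inverse q =>
      dsimp only
      by_cases e : i = nxt j
      · subst e
        rw [hi, hj] at hj2
        obtain ⟨a, ha, b, hb, -, hR⟩ := hj2
        simp [pathElem_mul_pathElem k p q b a hb ha hR]
      · exact Matrix.single_mul_single_of_ne _ _ _ _ e _

theorem bandMatrix_mul {w : List (Letter Q)} (hw : IsCyclicString R w) (lam : k)
    (m : Fin w.length) : bandMatrix k R w lam m * bandMatrix k R w lam m = 0 := by
  simp [bandMatrix, Finset.sum_mul, Finset.mul_sum, letterMatrix_mul k hw]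

theorem vecMul_bandMatrix_mem {w : List (Letter Q)} (hw : IsCyclicString R w) (lam : k)
    (m : Fin w.length) (d n n' : ℤ) (hn : n + 1 = n') (z : Fin w.length → Alg k R)
    (hz : z ∈ bandX k hw d n) :
    Matrix.vecMulLinear (bandMatrix k R w lam m) z ∈ bandX k hw d n' := by
  subst hn
  have single_mem : ∀ (j : Fin w.length) (y : Alg k R),
      (y ∈ if nodeDeg w d j = n + 1 then proj k R (nodeVtx hw j) else ⊥) →
      Pi.single j y ∈ bandX k hw d (n + 1) := by
    intro j y hy l _
    by_cases e : l = j
    · subst e; simpa using hy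
    · simp [Pi.single_eq_of_ne e]
  have vec : ∀ (a b : Fin w.length) (c : Alg k R),
      Matrix.vecMul z (Matrix.single a b c) = Pi.single b (z a * c) := by
    intro a b c
    ext l
    by_cases e : l = b
    · subst e
      simp [Matrix.vecMul, dotProduct, Matrix.single_apply]
    · simp [Matrix.vecMul, dotProduct, e, Ne.symm e]
  have zero : ∀ a : Fin w.length, nodeDeg w d a ≠ n → z a = 0 := by
    intro a ha
    have := hz a (Set.mem_univ a)
    simpa [ha] using this
  change Matrix.vecMul z (∑ i, letterMatrix k R w lam m i) ∈ _
  rw [Matrix.vecMul_sum]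
  refine Submodule.sum_mem _ fun i _ => ?_
  have hp := (hw.isPath _ (List.get_mem w i)).1
  have hdeg := nodeDeg_nxt hw d i
  unfold letterMatrix
  cases hi : w.get i with
  | direct p =>
    rw [hi] at hp hdeg
    rw [vec]
    apply single_mem
    split_ifs with h1 h2 h2
    · rw [nodeVtx_nxt hw i p hi hp]
      exact mul_mem_proj k _ _ p hp
    · rw [nodeVtx_nxt hw i p hi hp]
      exact mul_mem_proj k _ _ p hp
    · rw [zero i (fun e => h1 (by rw [hdeg, e]; rfl)), zero_mul]
      exact Submodule.zero_mem _
    · rw [zero i (fun e => h1 (by rw [hdeg, e]; rfl)), zero_mul]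
      exact Submodule.zero_mem _
  | inverse p =>
    rw [hi] at hp hdeg
    rw [vec]
    apply single_mem
    have hv : nodeVtx hw i = (p.getLast hp).left := by
      have key : ∀ (l : Letter Q) (hl : l.path ≠ []), l = .inverse p →
          l.leftEnd hl = (p.getLast hp).left := by
        rintro _ _ rfl
        rfl
      exact key _ _ hi
    have hne : nodeDeg w d i ≠ n + 1 → nodeDeg w d (nxt i) ≠ n := by
      intro h e
      rw [hdeg] at e
      exact h (by rw [← e]; simp [Letter.sgn])
    split_ifs with h1 h2 h2
    · rw [hv]
      exact mul_mem_proj k _ _ p hp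
    · rw [hv]
      exact mul_mem_proj k _ _ p hp
    · rw [zero _ (hne h1), zero_mul]
      exact Submodule.zero_mem _
    · rw [zero _ (hne h1), zero_mul]
      exact Submodule.zero_mem _

/-- The band complex `B_{w, lam}` with the scalar `lam` on the letter at position `m`, and with the
node to the left of the leftmost letter placed in degree `d`. -/
def bandComplex {w : List (Letter Q)} (hw : IsCyclicString R w) (lam : k) (m : Fin w.length)
    (d : ℤ) : CochainComplex (ModuleCat.{max u v w} (Alg k R)) ℤ where
  X n := ModuleCat.of (Alg k R) (bandX k hw d n)
  d n n' :=
    if h : n + 1 = n' then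
      ModuleCat.ofHom ((Matrix.vecMulLinear (bandMatrix k R w lam m)).restrict
        (vecMul_bandMatrix_mem k hw lam m d n n' h))
    else 0
  shape n n' h := dif_neg h
  d_comp_d' n n' n'' h h' := by
    have h : n + 1 = n' := h
    have h' : n' + 1 = n'' := h'
    rw [dif_pos h, dif_pos h']
    refine ModuleCat.hom_ext (LinearMap.ext fun z : bandX k hw d n => Subtype.ext ?_)
    change Matrix.vecMul (Matrix.vecMul z.1 (bandMatrix k R w lam m)) (bandMatrix k R w lam m) =
      (0 : Fin w.length → Alg k R)
    rw [Matrix.vecMul_vecMul, bandMatrix_mul k hw, Matrix.vecMul_zero]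

/-- `φ` is the map of band complexes whose only nonzero component is right multiplication by the
path `f`, from the node `i` of the first complex to the node `j` of the second one, two
nodes of the same degree. -/
def IsSingleMap {s t : List (Letter Q)} {hs : IsCyclicString R s} {ht : IsCyclicString R t}
    {lam mu : k} {m : Fin s.length} {m' : Fin t.length} {d d' : ℤ}
    (φ : bandComplex k hs lam m d ⟶ bandComplex k ht mu m' d')
    (f : List (Quiver.Total Q)) (i : Fin s.length) (j : Fin t.length) : Prop :=
  nodeDeg s d i = nodeDeg t d' j ∧
    ∀ (n : ℤ) (z : bandX k hs d n),
      ((φ.f n).hom z : bandX k ht d' n).1 = Pi.single j (z.1 i * pathElem k R f)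

end Band

/-! ### Singleton single maps -/

section Single

variable {Q : Type u} [Quiver.{v} Q]

/-- The position of `r` in the word `x l r y`; the node to the left of it lies between `l` and
`r`. -/
def midPos (x : List (Letter Q)) (l r : Letter Q) (y : List (Letter Q)) :
    Fin (x ++ [l, r] ++ y).length :=
  ⟨x.length + 1, by simp⟩

/-- The words `σ = β σ_L σ_R α` and `τ = δ τ_L τ_R γ` are compatibly oriented for the singleton
single map with component `f`, which goes from the node between `σ_L` and `σ_R` to the node between
`τ_L` and `τ_R`: here `σ_R = f f_R` and `τ_R = f̄ f̄_L` with `f`, `f_L`, `f_R` nontrivial, `σ_L f = 0`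
if `σ_L` is direct, and `f τ̄_L = 0` if `τ_L` is inverse. (That `σ_R` and `τ_R` are homotopy
letters of `σ` and `τ` makes `f f_R`, `f_L f` and their subpaths paths in `(Q, I)`.) -/
structure IsCompatibleSingleton (R : Quiver.Total Q → Quiver.Total Q → Prop)
    (σL σR τL τR : Letter Q) (fL f fR : List (Quiver.Total Q)) : Prop where
  f_isPath : IsPath R f
  fL_ne_nil : fL ≠ []
  fR_ne_nil : fR ≠ []
  right_top : σR = .direct (f ++ fR)
  right_bot : τR = .inverse (fL ++ f)
  left_top : ∀ p, σL = .direct p → ¬ IsPath R (p ++ f)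
  left_bot : ∀ p, τL = .inverse p → ¬ IsPath R (f ++ p)

/-- The word `c = β σ_L f τ̄_L δ̄ γ̄ (f_L f f_R) α`; note that `τ̄_R f̄ σ_R = f_L f f_R`. -/
def coneWord (β α δ γ : List (Letter Q)) (σL τL : Letter Q) (fL f fR : List (Quiver.Total Q)) :
    List (Letter Q) :=
  β ++ [σL, .direct f, τL.bar] ++ barWord δ ++ barWord γ ++ [.direct (fL ++ f ++ fR)] ++ α

end Single

end SingleMapCone

end

open SingleMapCone

namespace SingleMapCone

universe u v w

/-! ### Junctions of letters under inversion and under truncation -/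

section Junctions

variable {Q : Type u} [Quiver.{v} Q] {R : Quiver.Total Q → Quiver.Total Q → Prop}

/-! Let `S` and `T` be the differentials of the two band complexes and `F` the matrix with the
single entry `f`, all acting on row vectors from the right. The cone has the differential with block
rows `(-S, F)` and `(0, T)`. It is not yet a band complex: the letters `f f_R` and `f_L f` are still
present beside `f`, and the long letter `f_L f f_R` is missing.

Both defects are repaired by one unipotent base change with block rows `(1, 0)` and `(H, 1)`. The
matrix `H` (`shear`) has two entries: `f_R` (times the scalar on `f f_R`) from the target of `f` to
the right end of `σ_R`, and `f_L` from the right end of `τ_R` to the source of `f`. Then `F H` is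
the letter `f f_R` and cancels it in `-S`, while `H F` is the letter `f_L f` and cancels it in `T`.
The three products `H S`, `T H` and `H F H` all equal the matrix `L` of the long letter. For `H S`
and `T H` this is where gentleness enters: every other product vanishes, either by a relation at a
junction of the band, or because an arrow has at most one nonzero continuation. So the new
differential has block rows `(-S + F H, F)` and `(L, T - H F)`, whose entries are exactly the
letters of `c` with scalars attached (`coneMatrix_mul`).

The scalars matter only through the monodromy, the product of the weights of direct letters and
inverse weights of inverse letters around the cycle: a diagonal base change realises any
redistribution with the same monodromy (`exists_diagonal`). Here the monodromy is `-λ μ⁻¹`. Reading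
`τ` backwards inverts `μ`; the shift puts a sign on every letter of `σ` except the removed one, an
odd number of signs since a balanced word has even length (`prod_signedWeight`).

The combinatorics is done on the abstract node set of both bands with a cyclic successor
(`ConeData`), and only at the end transported to positions in the word `c` (`coneIndex_spec`).
There, the nodes of `σ` up to the source of `f` are followed by those of `τ` in reverse cyclic
order, then by the remaining nodes of `σ`. -/

theorem Letter.path_bar (l : Letter Q) : l.bar.path = l.path := by
  cases l <;> rfl

theorem Letter.sgn_bar (l : Letter Q) : l.bar.sgn = -l.sgn := by
  cases l <;> rfl

theorem Letter.isDirect_bar (l : Letter Q) : l.bar.isDirect = !l.isDirect := by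
  cases l <;> rfl

namespace Letter.Junction

protected theorem bar {l l' : Letter Q} (h : Junction R l l') : Junction R l'.bar l.bar := by
  cases l <;> cases l' <;> obtain ⟨b, hb, a, ha, h₁, h₂⟩ := h
  · exact ⟨a, ha, b, hb, h₁, h₂⟩
  · exact ⟨a, ha, b, hb, h₁.symm, h₂.symm⟩
  · exact ⟨a, ha, b, hb, h₁.symm, h₂.symm⟩
  · exact ⟨a, ha, b, hb, h₁, h₂⟩

/-- A junction sees only the arrows that touch the node, so a letter may be shortened or prolonged
at its far end. -/
theorem congr_head {l : Letter Q} {p q : List (Quiver.Total Q)}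
    (h : Junction R l (.direct p)) (e : p.head? = q.head?) : Junction R l (.direct q) := by
  cases l <;> simpa only [Junction, e] using h

theorem congr_getLast {l : Letter Q} {p q : List (Quiver.Total Q)}
    (h : Junction R (.direct p) l) (e : p.getLast? = q.getLast?) : Junction R (.direct q) l := by
  cases l <;> simpa only [Junction, e] using h

/-- `nodeVtx` reads the vertex of a node from the letter on its right. When a word is traversed
backwards that letter becomes the inverse of the one on the left, and both must give the same
vertex. -/
theorem leftEnd_bar {l l' : Letter Q} (h : Junction R l l') (hl : l.bar.path ≠ [])
    (hl' : l'.path ≠ []) : l.bar.leftEnd hl = l'.leftEnd hl' := by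
  cases l <;> cases l' <;> obtain ⟨b, hb, a, ha, h₁, h₂⟩ := h <;>
    simp only [Letter.bar, Letter.leftEnd] <;>
    simp only [Letter.bar, Letter.path] at hl hl' <;>
    simp_all [List.getLast?_eq_some_getLast, List.head?_eq_some_head]

end Letter.Junction

theorem IsPath.of_append_left {p q : List (Quiver.Total Q)} (h : IsPath R (p ++ q)) (hp : p ≠ []) :
    IsPath R p :=
  ⟨hp, (List.isChain_append.1 h.2).1⟩

/-- Two paths which overlap in a nontrivial path can be glued. -/
theorem IsPath.glue {p q r : List (Quiver.Total Q)} (h : IsPath R (p ++ q)) (h' : IsPath R (q ++ r))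
    (hq : q ≠ []) : IsPath R (p ++ q ++ r) := by
  refine ⟨by simp [hq], List.isChain_append.2 ⟨h.2, (List.isChain_append.1 h'.2).2.1, ?_⟩⟩
  intro b hb a ha
  refine (List.isChain_append.1 h'.2).2.2 b ?_ a ha
  rwa [List.getLast?_append_of_ne_nil _ hq] at hb

/-- This is the place in `c` where `f` meets the inverse of `τ_L`: reverse the junction of `τ_L` and
`τ_R`, then cut off `f_L`. -/
theorem Letter.Junction.direct_bar {l : Letter Q} {g f : List (Quiver.Total Q)} (hf : f ≠ [])
    (h : Letter.Junction R l (.inverse (g ++ f))) : Letter.Junction R (.direct f) l.bar :=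
  h.bar.congr_getLast (List.getLast?_append_of_ne_nil _ hf)

end Junctions

/-! ### Vanishing products of paths -/

section Products

variable (k : Type w) [Field k] {Q : Type u} [Quiver.{v} Q] [Fintype Q]
  {R : Quiver.Total Q → Quiver.Total Q → Prop}

theorem pathElem_append (p q : List (Quiver.Total Q)) :
    pathElem k R (p ++ q) = pathElem k R p * pathElem k R q := by
  simp [pathElem]

/-- If two different arrows `b`, `b'` start where `a` ends and `b a ≠ 0`, then `b' a = 0`. -/
theorem pathElem_mul_eq_zero_of_junction_left (hR : IsGentle R) {q g f r : List (Quiver.Total Q)}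
    (hf : f ≠ []) (hr : r ≠ []) (hfr : IsPath R (f ++ r))
    (h : Letter.Junction R (.direct q) (.inverse (g ++ f))) :
    pathElem k R q * pathElem k R r = 0 := by
  obtain ⟨b', hb', b, hb, h₁, h₂⟩ := h
  rw [List.getLast?_append_of_ne_nil _ hf] at hb
  obtain ⟨a, ha⟩ : ∃ a, a ∈ r.head? := ⟨_, List.head?_eq_some_head hr⟩
  have hba := (List.isChain_append.1 hfr.2).2.2 b hb a ha
  refine pathElem_mul_pathElem k q r b' a hb' ha (by_contra fun hn => h₂ ?_)
  exact hR.nonzero_left a ⟨h₁.trans hba.1, hn⟩ hba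

/-- If two different arrows `a`, `a'` end where `b` starts and `b a ≠ 0`, then `b a' = 0`. -/
theorem pathElem_mul_eq_zero_of_junction_right (hR : IsGentle R) {q g f r : List (Quiver.Total Q)}
    (hf : f ≠ []) (hr : r ≠ []) (hrf : IsPath R (r ++ f))
    (h : Letter.Junction R (.inverse q) (.direct (f ++ g))) :
    pathElem k R r * pathElem k R q = 0 := by
  obtain ⟨a', ha', a, ha, h₁, h₂⟩ := h
  rw [List.head?_append_of_ne_nil _ hf] at ha
  obtain ⟨b, hb⟩ : ∃ b, b ∈ r.getLast? := ⟨_, List.getLast?_eq_some_getLast hr⟩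
  have hba := (List.isChain_append.1 hrf.2).2.2 b hb a ha
  refine pathElem_mul_pathElem k r q b a' hb ha' (by_contra fun hn => h₂ ?_)
  exact hR.nonzero_right b ⟨hba.1.trans h₁.symm, hn⟩ hba

/-- The relation sits between the last arrow of `r` and the first of `q`, so it survives cutting off
`f`. -/
theorem pathElem_mul_eq_zero_of_junction_direct {f r q : List (Quiver.Total Q)} (hr : r ≠ [])
    (h : Letter.Junction R (.direct (f ++ r)) (.direct q)) :
    pathElem k R r * pathElem k R q = 0 := by
  obtain ⟨b, hb, a, ha, -, h₂⟩ := h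
  rw [List.getLast?_append_of_ne_nil _ hr] at hb
  exact pathElem_mul_pathElem k r q b a hb ha h₂

theorem pathElem_mul_eq_zero_of_junction_inverse {f r q : List (Quiver.Total Q)} (hr : r ≠ [])
    (h : Letter.Junction R (.inverse (r ++ f)) (.inverse q)) :
    pathElem k R q * pathElem k R r = 0 := by
  obtain ⟨a, ha, b, hb, -, h₂⟩ := h
  rw [List.head?_append_of_ne_nil _ hr] at ha
  exact pathElem_mul_pathElem k q r b a hb ha h₂

end Products

/-! ### The cyclic family of nodes and letters of the cone -/

section ConeLetters

variable {Q : Type u} [Quiver.{v} Q]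

/-- The cyclic successor as a permutation. -/
@[simps! apply]
noncomputable def nxtEquiv (n : ℕ) : Equiv.Perm (Fin n) :=
  Equiv.ofBijective nxt (Finite.injective_iff_bijective.1 nxt_injective)

/-- Two bands given as words `s` and `t`, with positions `x` and `y` at which the letters are
`f f_R` and the inverse of `f_L f`. -/
structure ConeData (R : Quiver.Total Q → Quiver.Total Q → Prop) where
  (s t : List (Letter Q))
  hs : IsCyclicString R s
  ht : IsCyclicString R t
  x : Fin s.length
  y : Fin t.length
  (fL f fR : List (Quiver.Total Q))
  fL_ne_nil : fL ≠ []
  f_ne_nil : f ≠ []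
  fR_ne_nil : fR ≠ []
  get_x : s.get x = .direct (f ++ fR)
  get_y : t.get y = .inverse (fL ++ f)

namespace ConeData

variable {R : Quiver.Total Q → Quiver.Total Q → Prop} (D : ConeData R)

/-- The nodes of the cone. -/
abbrev Node : Type := Fin D.s.length ⊕ Fin D.t.length

/-- The node following a node when the cyclic word of the cone is read from left to right. -/
noncomputable def next : D.Node → D.Node
  | .inl i => if i = D.x then .inr D.y else .inl (nxt i)
  | .inr j => if j = nxt D.y then .inl (nxt D.x) else .inr ((nxtEquiv _).symm j)

/-- The letter to the right of a node in the cyclic word of the cone. -/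
noncomputable def letter : D.Node → Letter Q
  | .inl i => if i = D.x then .direct D.f else D.s.get i
  | .inr j => if j = nxt D.y then .direct (D.fL ++ D.f ++ D.fR)
      else (D.t.get ((nxtEquiv _).symm j)).bar

@[simp] theorem next_inl_x : D.next (.inl D.x) = .inr D.y := if_pos rfl

theorem next_inl {i : Fin D.s.length} (h : i ≠ D.x) : D.next (.inl i) = .inl (nxt i) := if_neg h

@[simp] theorem next_inr_nxt_y : D.next (.inr (nxt D.y)) = .inl (nxt D.x) := if_pos rfl

theorem next_inr_nxt {j : Fin D.t.length} (h : j ≠ D.y) : D.next (.inr (nxt j)) = .inr j := by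
  rw [next, if_neg (fun e => h (nxt_injective e))]
  exact congrArg _ ((nxtEquiv _).symm_apply_apply j)

@[simp] theorem letter_inl_x : D.letter (.inl D.x) = .direct D.f := if_pos rfl

theorem letter_inl {i : Fin D.s.length} (h : i ≠ D.x) : D.letter (.inl i) = D.s.get i := if_neg h

@[simp] theorem letter_inr_nxt_y :
    D.letter (.inr (nxt D.y)) = .direct (D.fL ++ D.f ++ D.fR) := if_pos rfl

theorem letter_inr_nxt {j : Fin D.t.length} (h : j ≠ D.y) :
    D.letter (.inr (nxt j)) = (D.t.get j).bar := by
  rw [letter, if_neg (fun e => h (nxt_injective e))]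
  exact congrArg (fun a => (D.t.get a).bar) ((nxtEquiv _).symm_apply_apply j)

/-- Case distinction on the nodes of the cone. -/
@[elab_as_elim]
theorem node_cases {p : D.Node → Prop} (hx : p (.inl D.x)) (hl : ∀ i, i ≠ D.x → p (.inl i))
    (hy : p (.inr (nxt D.y))) (hr : ∀ j, j ≠ D.y → p (.inr (nxt j))) (a : D.Node) : p a := by
  rcases a with i | j
  · by_cases h : i = D.x
    · exact h ▸ hx
    · exact hl i h
  · obtain ⟨j, rfl⟩ := (nxtEquiv _).surjective j
    by_cases h : j = D.y
    · exact h ▸ hy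
    · exact hr j h

theorem isPath_f_fR : IsPath R (D.f ++ D.fR) := by
  have := D.hs.isPath _ (List.get_mem D.s D.x)
  rwa [D.get_x] at this

theorem isPath_fL_f : IsPath R (D.fL ++ D.f) := by
  have := D.ht.isPath _ (List.get_mem D.t D.y)
  rwa [D.get_y] at this

theorem isPath_letter (a : D.Node) : IsPath R (D.letter a).path := by
  refine D.node_cases ?_ (fun i h => ?_) ?_ (fun j h => ?_) a
  · rw [letter_inl_x]
    exact D.isPath_f_fR.of_append_left D.f_ne_nil
  · rw [D.letter_inl h]
    exact D.hs.isPath _ (List.get_mem _ _)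
  · rw [letter_inr_nxt_y]
    exact D.isPath_fL_f.glue D.isPath_f_fR D.f_ne_nil
  · rw [D.letter_inr_nxt h, Letter.path_bar]
    exact D.ht.isPath _ (List.get_mem _ _)

end ConeData

/-- A cyclic string has at least two letters. -/
theorem IsCyclicString.nxt_ne {R : Quiver.Total Q → Quiver.Total Q → Prop} {w : List (Letter Q)}
    (hw : IsCyclicString R w) (i : Fin w.length) : nxt i ≠ i := by
  intro h
  have h1 : w.length = 1 := by
    have h' : (i.1 + 1) % w.length = i.1 := congrArg Fin.val h
    have hi := i.2
    rcases Nat.lt_or_ge (i.1 + 1) w.length with hlt | hge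
    · rw [Nat.mod_eq_of_lt hlt] at h'
      omega
    · rw [show i.1 + 1 = w.length by omega, Nat.mod_self] at h'
      omega
  obtain ⟨l, rfl⟩ := List.length_eq_one_iff.1 h1
  have := hw.balanced
  cases l <;> simp [Letter.isDirect] at this

namespace ConeData

variable {R : Quiver.Total Q → Quiver.Total Q → Prop} (D : ConeData R)

/-- This `j` is the position of `τ_L`, whose inverse follows `f` in the cone. -/
theorem exists_nxt_eq_y : ∃ j, j ≠ D.y ∧ nxt j = D.y := by
  obtain ⟨j, hj⟩ := (nxtEquiv _).surjective D.y
  exact ⟨j, fun e => D.ht.nxt_ne D.y (by rw [← e]; exact hj.trans e.symm), hj⟩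

theorem junction_x : Letter.Junction R (.direct (D.f ++ D.fR)) (D.s.get (nxt D.x)) :=
  D.get_x ▸ D.hs.junction D.x

theorem junction_y : Letter.Junction R (.inverse (D.fL ++ D.f)) (D.t.get (nxt D.y)) :=
  D.get_y ▸ D.ht.junction D.y

/-- Away from the surgery the junctions are those of `σ`, or of `τ` reversed. At the new letters
only the far ends of `f f_R` and `f_L f` have changed: `f` keeps the first arrow of `f f_R` and the
last of `f_L f`, and the long letter keeps the other two extremities. -/
theorem junction_letter (a : D.Node) :
    Letter.Junction R (D.letter a) (D.letter (D.next a)) := by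
  refine D.node_cases ?_ (fun i h => ?_) ?_ (fun j h => ?_) a
  · rw [letter_inl_x, next_inl_x]
    obtain ⟨j, hj, e⟩ := D.exists_nxt_eq_y
    rw [← e, D.letter_inr_nxt hj]
    have := D.ht.junction j
    rw [e, D.get_y] at this
    exact this.direct_bar D.f_ne_nil
  · rw [D.letter_inl h, D.next_inl h]
    have := D.hs.junction i
    by_cases h' : nxt i = D.x
    · rw [h', letter_inl_x]
      rw [h', D.get_x] at this
      exact this.congr_head (List.head?_append_of_ne_nil _ D.f_ne_nil)
    · rwa [D.letter_inl h']
  · rw [letter_inr_nxt_y, next_inr_nxt_y, D.letter_inl (D.hs.nxt_ne D.x)]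
    refine D.junction_x.congr_getLast ?_
    rw [List.getLast?_append_of_ne_nil _ D.fR_ne_nil, List.getLast?_append_of_ne_nil _ D.fR_ne_nil]
  · rw [D.letter_inr_nxt h, D.next_inr_nxt h]
    obtain ⟨i, rfl⟩ := (nxtEquiv _).surjective j
    have := (D.ht.junction i).bar
    rw [nxtEquiv_apply] at h ⊢
    by_cases h' : i = D.y
    · subst h'
      rw [letter_inr_nxt_y]
      rw [D.get_y] at this
      refine Letter.Junction.congr_head (p := D.fL ++ D.f) this ?_
      rw [List.append_assoc, List.head?_append_of_ne_nil _ D.fL_ne_nil,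
        List.head?_append_of_ne_nil _ D.fL_ne_nil]
    · rwa [D.letter_inr_nxt h']

/-- The vertex at a node of the cone. -/
def vertex : D.Node → Q :=
  Sum.elim (nodeVtx D.hs) (nodeVtx D.ht)

theorem leftEnd_eq_of_eq {l l' : Letter Q} (e : l = l') (h : l.path ≠ []) (h' : l'.path ≠ []) :
    l.leftEnd h = l'.leftEnd h' := by
  subst e
  rfl

theorem leftEnd_direct_of_head {p q : List (Quiver.Total Q)} (hp : p ≠ []) (hq : q ≠ [])
    (e : p.head? = q.head?) :
    (Letter.direct p).leftEnd hp = (Letter.direct q).leftEnd hq := by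
  rw [List.head?_eq_some_head hp, List.head?_eq_some_head hq] at e
  exact congrArg Quiver.Total.right (Option.some.inj e)

theorem leftEnd_letter (a : D.Node) :
    (D.letter a).leftEnd (D.isPath_letter a).1 = D.vertex a := by
  refine D.node_cases ?_ (fun i h => ?_) ?_ (fun j h => ?_) a
  · rw [leftEnd_eq_of_eq D.letter_inl_x _ D.f_ne_nil]
    refine Eq.trans ?_ (leftEnd_eq_of_eq D.get_x.symm (by simp [Letter.path, D.f_ne_nil]) _)
    exact leftEnd_direct_of_head _ _ (List.head?_append_of_ne_nil _ D.f_ne_nil).symm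
  · exact leftEnd_eq_of_eq (D.letter_inl h) _ _
  · rw [leftEnd_eq_of_eq D.letter_inr_nxt_y _ (by simp [Letter.path, D.f_ne_nil])]
    -- The long letter starts with the same arrow as `f_L f`, the inverse of the letter just left of
    -- this node in `τ`.
    refine Eq.trans ?_ (D.junction_y.leftEnd_bar (by simp [Letter.bar, Letter.path, D.f_ne_nil])
      (D.ht.isPath _ (List.get_mem _ _)).1)
    refine leftEnd_direct_of_head _ _ ?_
    rw [List.append_assoc, List.head?_append_of_ne_nil _ D.fL_ne_nil,
        List.head?_append_of_ne_nil _ D.fL_ne_nil]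
  · have := (D.ht.isPath _ (List.get_mem D.t j)).1
    rw [leftEnd_eq_of_eq (D.letter_inr_nxt h) _ (by rwa [Letter.path_bar])]
    exact (D.ht.junction j).leftEnd_bar _ _

/-- The degree of a node of the cone. -/
def degree (d d' : ℤ) : D.Node → ℤ :=
  Sum.elim (fun i => nodeDeg D.s d i - 1) (fun j => nodeDeg D.t d' j)

/-- The shift by one on the nodes of `σ` is what turns `f`, a component of degree 0, into a letter
of degree 1. The long letter joins `nxt D.y`, one degree below `D.y`, to `nxt D.x`, which the shift
brings down to the degree of `D.y`. -/
theorem degree_next {d d' : ℤ} (h : nodeDeg D.s d D.x = nodeDeg D.t d' D.y) (a : D.Node) :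
    D.degree d d' (D.next a) = D.degree d d' a + (D.letter a).sgn := by
  have hx := nodeDeg_nxt D.hs d D.x
  have hy := nodeDeg_nxt D.ht d' D.y
  rw [D.get_x] at hx
  rw [D.get_y] at hy
  simp only [Letter.sgn] at hx hy
  refine D.node_cases ?_ (fun i h => ?_) ?_ (fun j h => ?_) a
  · simp [degree, Letter.sgn, h]
  · rw [D.letter_inl h, D.next_inl h]
    have := nodeDeg_nxt D.hs d i
    simp only [degree, Sum.elim_inl]
    linarith
  · simp only [next_inr_nxt_y, letter_inr_nxt_y, degree, Sum.elim_inl, Sum.elim_inr, Letter.sgn]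
    linarith
  · rw [D.letter_inr_nxt h, D.next_inr_nxt h, Letter.sgn_bar]
    have := nodeDeg_nxt D.ht d' j
    simp only [degree, Sum.elim_inr]
    linarith

end ConeData

end ConeLetters

/-! ### Cyclic words with arbitrary scalars, and their monodromy -/

section Weighted

variable (k : Type w) [Field k] {Q : Type u} [Quiver.{v} Q] [Fintype Q]
  (R : Quiver.Total Q → Quiver.Total Q → Prop)
  {J J' : Type*} [DecidableEq J] [DecidableEq J']

/-- The matrix with a single entry, given by a letter from node `a` to node `b` with a scalar. -/
noncomputable def letterEntry (l : Letter Q) (a b : J) (c : k) : Matrix J J (Alg k R) :=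
  match l with
  | .direct p => Matrix.single a b (c • pathElem k R p)
  | .inverse p => Matrix.single b a (c • pathElem k R p)

/-- The matrix of a cyclic family of letters with arbitrary scalars. -/
noncomputable def weightedMatrix [Fintype J] (l : J → Letter Q) (ν : J → J) (κ : J → k) :
    Matrix J J (Alg k R) :=
  ∑ j, letterEntry k R (l j) j (ν j) (κ j)

/-- The scalar with which a letter contributes to the monodromy. -/
def signedWeight {k : Type w} [Field k] (l : Letter Q) (c : k) : k :=
  match l with
  | .direct _ => c
  | .inverse _ => c⁻¹

theorem bandMatrix_eq (w : List (Letter Q)) (lam : k) (m : Fin w.length) :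
    bandMatrix k R w lam m = weightedMatrix k R w.get nxt (fun i => if i = m then lam else 1) :=
  rfl

theorem letterEntry_bar (l : Letter Q) (a b : J) (c : k) :
    letterEntry k R l.bar a b c = letterEntry k R l b a c := by
  cases l <;> rfl

theorem letterEntry_neg (l : Letter Q) (a b : J) (c : k) :
    letterEntry k R l a b (-c) = -letterEntry k R l a b c := by
  have h (p : List (Quiver.Total Q)) : (-c) • pathElem k R p = -(c • pathElem k R p) :=
    eq_neg_of_add_eq_zero_left (by rw [← add_smul, neg_add_cancel, zero_smul])
  cases l <;> ext i j <;> simp only [letterEntry, h, Matrix.single_apply, Matrix.neg_apply] <;>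
    split_ifs <;> simp

theorem letterEntry_submatrix (l : Letter Q) (e : J' ≃ J) (a b : J') (c : k) :
    (letterEntry k R l (e a) (e b) c).submatrix e e = letterEntry k R l a b c := by
  cases l <;> ext i j <;> simp [letterEntry, Matrix.single_apply]

theorem weightedMatrix_submatrix [Fintype J] [Fintype J'] {l : J → Letter Q} {ν : J → J} (κ : J → k) (e : J' ≃ J)
    {l' : J' → Letter Q} {ν' : J' → J'} (hl : ∀ i, l' i = l (e i)) (hν : ∀ i, e (ν' i) = ν (e i)) :
    (weightedMatrix k R l ν κ).submatrix e e = weightedMatrix k R l' ν' (κ ∘ e) := by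
  unfold weightedMatrix
  rw [← e.sum_comp]
  ext i j
  simp only [Matrix.submatrix_apply, Matrix.sum_apply]
  refine Finset.sum_congr rfl fun a _ => ?_
  rw [← hν, ← hl, Function.comp_apply, ← letterEntry_submatrix k R (l' a) e a (ν' a)]
  rfl

/-- Rescaling the nodes by `t` changes the signed weight of a letter by the ratio of `t` at its two
ends. Inverting the weight of an inverse letter makes this one formula for both directions. -/
theorem letterEntry_mul_diagonal [Fintype J] (l : Letter Q) (a b : J) {c c' : k} {t : J → k}
    (hc : c ≠ 0) (hc' : c' ≠ 0)
    (h : t b * signedWeight l c = t a * signedWeight l c') :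
    letterEntry k R l a b c * Matrix.diagonal (fun j => algebraMap k (Alg k R) (t j)) =
      Matrix.diagonal (fun j => algebraMap k (Alg k R) (t j)) * letterEntry k R l a b c' := by
  cases l with
  | direct p =>
    ext i j
    simp only [letterEntry, Matrix.mul_diagonal, Matrix.diagonal_mul, Matrix.single_apply]
    split_ifs with e
    · obtain ⟨rfl, rfl⟩ := e
      rw [← Algebra.commutes, ← Algebra.smul_def, ← Algebra.smul_def, smul_smul, smul_smul]
      exact congrArg (· • _) h
    · simp
  | inverse p =>
    ext i j
    simp only [letterEntry, Matrix.mul_diagonal, Matrix.diagonal_mul, Matrix.single_apply]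
    split_ifs with e
    · obtain ⟨rfl, rfl⟩ := e
      rw [← Algebra.commutes, ← Algebra.smul_def, ← Algebra.smul_def, smul_smul, smul_smul]
      simp only [signedWeight] at h
      refine congrArg (· • _) ?_
      field_simp at h
      rw [mul_comm, h]
    · simp

/-- Scalars on a cyclic word can be moved as long as the monodromy does not change. -/
theorem exists_diagonal (w : List (Letter Q)) {κ κ' : Fin w.length → k} (hκ : ∀ i, κ i ≠ 0)
    (hκ' : ∀ i, κ' i ≠ 0)
    (h : ∏ i, signedWeight (w.get i) (κ i) = ∏ i, signedWeight (w.get i) (κ' i)) :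
    ∃ t : Fin w.length → k, (∀ i, t i ≠ 0) ∧
      weightedMatrix k R w.get nxt κ * Matrix.diagonal (fun j => algebraMap k (Alg k R) (t j)) =
        Matrix.diagonal (fun j => algebraMap k (Alg k R) (t j)) *
          weightedMatrix k R w.get nxt κ' := by
  have hs : ∀ (l : Letter Q) (c : k), c ≠ 0 → signedWeight l c ≠ 0 := by
    rintro (p | p) c hc
    · exact hc
    · exact inv_ne_zero hc
  -- The factor by which the scalar at position `i` has to change. The node scalars `t` are the
  -- partial products of these factors; the value 1 beyond the word is a filler.
  let r : ℕ → k := fun i => if h : i < w.length then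
    signedWeight (w.get ⟨i, h⟩) (κ' ⟨i, h⟩) / signedWeight (w.get ⟨i, h⟩) (κ ⟨i, h⟩) else 1
  have hr : ∀ i : Fin w.length,
      r i = signedWeight (w.get i) (κ' i) / signedWeight (w.get i) (κ i) := fun i => dif_pos i.2
  have hr0 : ∀ i, r i ≠ 0 := by
    intro i
    by_cases hi : i < w.length
    · rw [hr ⟨i, hi⟩]
      exact div_ne_zero (hs _ _ (hκ' _)) (hs _ _ (hκ _))
    · simp [r, hi]
  -- Equality of the monodromies is exactly what makes the partial products close up at the step
  -- from the last node to the first.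
  have hprod : ∏ i ∈ Finset.range w.length, r i = 1 := by
    rw [← Fin.prod_univ_eq_prod_range, Finset.prod_congr rfl fun i _ => hr i,
      Finset.prod_div_distrib, h, div_self]
    exact Finset.prod_ne_zero_iff.2 fun i _ => hs _ _ (hκ' i)
  have hnxt : ∀ i : Fin w.length, ∏ a ∈ Finset.range (nxt i), r a =
      (∏ a ∈ Finset.range i, r a) * r i := by
    intro i
    rw [← Finset.prod_range_succ]
    rcases Nat.lt_or_ge (i.1 + 1) w.length with hi | hi
    · simp [nxt, Nat.mod_eq_of_lt hi]
    · have e : i.1 + 1 = w.length := le_antisymm i.2 hi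
      simp [nxt, e, hprod]
  refine ⟨fun j => ∏ a ∈ Finset.range j, r a, fun j => Finset.prod_ne_zero_iff.2 fun a _ => hr0 a,
    ?_⟩
  rw [weightedMatrix, weightedMatrix, Finset.sum_mul, Finset.mul_sum]
  refine Finset.sum_congr rfl fun i _ => letterEntry_mul_diagonal k R _ _ _
    (hκ i) (hκ' i) ?_
  rw [hnxt, hr, mul_assoc, div_mul_cancel₀ _ (hs _ _ (hκ i))]

end Weighted

/-! ### The base change of the cone differential -/

section ConeMatrix

theorem fromBlocks_sum {ι l m n o α : Type*} [AddCommMonoid α] (s : Finset ι)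
    (A : ι → Matrix n l α) (B : ι → Matrix n m α) (C : ι → Matrix o l α) (D : ι → Matrix o m α) :
    ∑ i ∈ s, Matrix.fromBlocks (A i) (B i) (C i) (D i) =
      Matrix.fromBlocks (∑ i ∈ s, A i) (∑ i ∈ s, B i) (∑ i ∈ s, C i) (∑ i ∈ s, D i) := by
  ext (i | i) (j | j) <;> simp [Matrix.sum_apply]

variable (k : Type w) [Field k] {Q : Type u} [Quiver.{v} Q]
  {R : Quiver.Total Q → Quiver.Total Q → Prop}

namespace ConeData

variable (D : ConeData R) (κ : Fin D.s.length → k) (κ' : Fin D.t.length → k)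

/-- The scalars on the letters of the cone. -/
noncomputable def weight : D.Node → k
  -- The signs come from the shift of `σ` in the cone. The letter `f` carries no scalar; that of
  -- `σ_R` passes to the long letter.
  | .inl i => if i = D.x then 1 else -κ i
  | .inr j => if j = nxt D.y then κ D.x else κ' ((nxtEquiv _).symm j)

theorem weight_inr_nxt {j : Fin D.t.length} (h : j ≠ D.y) :
    D.weight k κ κ' (.inr (nxt j)) = κ' j := by
  rw [weight, if_neg (fun e => h (nxt_injective e))]
  exact congrArg κ' ((nxtEquiv _).symm_apply_apply j)

variable {k κ κ'} in
theorem weight_ne_zero (hκ : ∀ i, κ i ≠ 0) (hκ' : ∀ i, κ' i ≠ 0) (a : D.Node) :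
    D.weight k κ κ' a ≠ 0 := by
  cases a <;> simp only [weight] <;> split_ifs <;> simp [hκ, hκ']

theorem prod_signedWeight (hy : κ' D.y = 1) (hx : κ D.x ≠ 0) :
    ∏ a, signedWeight (D.letter a) (D.weight k κ κ' a) =
      -((∏ i, signedWeight (D.s.get i) (κ i)) * (∏ j, signedWeight (D.t.get j) (κ' j))⁻¹) := by
  have hl (i) : signedWeight (D.letter (.inl i)) (D.weight k κ κ' (.inl i)) =
      (if i = D.x then -(κ D.x)⁻¹ else 1) * (-1 * signedWeight (D.s.get i) (κ i)) := by
    by_cases e : i = D.x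
    · subst e
      rw [D.get_x]
      simp [weight, signedWeight, hx]
    · rw [if_neg e, D.letter_inl e, weight, if_neg e]
      cases D.s.get i <;> simp [signedWeight, inv_neg]
  have hr (j) : signedWeight (D.letter (.inr (nxt j))) (D.weight k κ κ' (.inr (nxt j))) =
      (if j = D.y then κ D.x else 1) * (signedWeight (D.t.get j) (κ' j))⁻¹ := by
    by_cases e : j = D.y
    · subst e
      rw [D.get_y]
      simp [weight, signedWeight, hy]
    · rw [if_neg e, D.letter_inr_nxt e, D.weight_inr_nxt k κ κ' e]
      cases D.t.get j <;> simp [signedWeight, Letter.bar]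
  -- Factoring -1 out of every letter of `s` costs nothing because their number is even; the
  -- compensating sign at `D.x` alone remains.
  have heven : Even D.s.length := by
    have := List.length_eq_countP_add_countP (fun l : Letter Q => l.isDirect) (l := D.s)
    have hb := D.hs.balanced
    simp only [Bool.not_eq_true, Bool.decide_eq_false] at this
    exact ⟨_, by rw [this, hb]⟩
  rw [Fintype.prod_sum_type, ← Equiv.prod_comp (nxtEquiv D.t.length)]
  simp only [nxtEquiv_apply, hl, hr, Finset.prod_mul_distrib, Finset.prod_ite_eq', Finset.mem_univ,
    if_true, Finset.prod_const, Finset.card_univ, Fintype.card_fin, heven.neg_one_pow,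
    Finset.prod_inv_distrib]
  field_simp

variable [Fintype Q]

/-- The matrix of the single map. -/
noncomputable def mapMatrix : Matrix (Fin D.s.length) (Fin D.t.length) (Alg k R) :=
  Matrix.single D.x D.y (pathElem k R D.f)

/-- The off-diagonal part of the base change. -/
noncomputable def shear : Matrix (Fin D.t.length) (Fin D.s.length) (Alg k R) :=
  κ D.x • Matrix.single D.y (nxt D.x) (pathElem k R D.fR) +
    Matrix.single (nxt D.y) D.x (pathElem k R D.fL)

/-- The matrix of the long letter `f_L f f_R`. -/
noncomputable def longMatrix : Matrix (Fin D.t.length) (Fin D.s.length) (Alg k R) :=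
  κ D.x • Matrix.single (nxt D.y) (nxt D.x) (pathElem k R (D.fL ++ D.f ++ D.fR))

theorem mapMatrix_mul_shear : D.mapMatrix k * D.shear k κ =
    κ D.x • Matrix.single D.x (nxt D.x) (pathElem k R (D.f ++ D.fR)) := by
  rw [mapMatrix, shear, Matrix.mul_add, Matrix.mul_smul, Matrix.single_mul_single_same,
    Matrix.single_mul_single_of_ne _ _ _ _ (D.ht.nxt_ne D.y).symm, add_zero, pathElem_append]

theorem shear_mul_mapMatrix : D.shear k κ * D.mapMatrix k =
    Matrix.single (nxt D.y) D.y (pathElem k R (D.fL ++ D.f)) := by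
  rw [mapMatrix, shear, Matrix.add_mul, Matrix.smul_mul, Matrix.single_mul_single_same,
    Matrix.single_mul_single_of_ne _ _ _ _ (D.hs.nxt_ne D.x), smul_zero, zero_add, pathElem_append]

theorem shear_mul_mapMatrix_mul_shear :
    D.shear k κ * D.mapMatrix k * D.shear k κ = D.longMatrix k κ := by
  rw [shear_mul_mapMatrix, shear, Matrix.mul_add, Matrix.mul_smul, Matrix.single_mul_single_same,
    Matrix.single_mul_single_of_ne _ _ _ _ (D.ht.nxt_ne D.y).symm, add_zero, longMatrix,
    pathElem_append k _ D.fR]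

/-- Follow the components of the differential that leave the targets of `H`. After `f_R` there can
only be the next letter of `σ`, if direct, and the product is killed by the relation at that
junction. After `f_L` there is `f f_R`, giving the long letter, or the path of an inverse `σ_L`,
which gentleness kills since `f_L f` is nonzero. -/
theorem shear_mul_weightedMatrix (hR : IsGentle R) :
    D.shear k κ * weightedMatrix k R D.s.get nxt κ = D.longMatrix k κ := by
  have h1 (i) : Matrix.single D.y (nxt D.x) (pathElem k R D.fR) *
      letterEntry k R (D.s.get i) i (nxt i) (κ i) = 0 := by
    generalize hl : D.s.get i = l
    cases l with
    | direct p =>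
      by_cases e : nxt D.x = i
      · have := D.junction_x
        rw [e, hl] at this
        rw [e, letterEntry, Matrix.single_mul_single_same, mul_smul_comm,
          pathElem_mul_eq_zero_of_junction_direct k D.fR_ne_nil this, smul_zero,
          Matrix.single_zero]
      · exact Matrix.single_mul_single_of_ne _ _ _ _ e _
    | inverse p =>
      refine Matrix.single_mul_single_of_ne _ _ _ _ (fun e => ?_) _
      rw [← nxt_injective e, D.get_x] at hl
      cases hl
  have h2 (i) : Matrix.single (nxt D.y) D.x (pathElem k R D.fL) *
      letterEntry k R (D.s.get i) i (nxt i) (κ i) = if i = D.x then D.longMatrix k κ else 0 := by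
    split_ifs with e
    · rw [e, D.get_x, letterEntry, Matrix.single_mul_single_same, longMatrix, List.append_assoc,
        pathElem_append k D.fL, mul_smul_comm, Matrix.smul_single]
    generalize hl : D.s.get i = l
    cases l with
    | direct p => exact Matrix.single_mul_single_of_ne _ _ _ _ (Ne.symm e) _
    | inverse p =>
      by_cases e' : D.x = nxt i
      · have := D.hs.junction i
        rw [← e', hl, D.get_x] at this
        rw [e', letterEntry, Matrix.single_mul_single_same, mul_smul_comm,
          pathElem_mul_eq_zero_of_junction_right k hR D.f_ne_nil D.fL_ne_nil D.isPath_fL_f this,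
          smul_zero, Matrix.single_zero]
      · exact Matrix.single_mul_single_of_ne _ _ _ _ e' _
  simp only [shear, weightedMatrix, Matrix.add_mul, Matrix.smul_mul, Matrix.mul_sum, h1, h2,
    smul_zero, zero_add, Finset.sum_ite_eq', Finset.mem_univ, if_true]

/-- Dually, follow the components that enter the sources of `H`. Before `f_L` only an inverse letter
next to `τ_R` matters, and it makes a relation. Before `f_R` there is `f_L f`, giving the long
letter, or a direct `τ_L`, which gentleness kills. The scalar on `f_L f` must be 1 for the outcome
to be the same matrix as for `σ`. -/
theorem weightedMatrix_mul_shear (hR : IsGentle R) (h : κ' D.y = 1) :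
    weightedMatrix k R D.t.get nxt κ' * D.shear k κ = D.longMatrix k κ := by
  have h1 (j) : letterEntry k R (D.t.get j) j (nxt j) (κ' j) *
      Matrix.single (nxt D.y) D.x (pathElem k R D.fL) = 0 := by
    generalize hl : D.t.get j = l
    cases l with
    | inverse p =>
      by_cases e : j = nxt D.y
      · have := D.junction_y
        rw [← e, hl] at this
        rw [← e, letterEntry, Matrix.single_mul_single_same, smul_mul_assoc,
          pathElem_mul_eq_zero_of_junction_inverse k D.fL_ne_nil this, smul_zero,
          Matrix.single_zero]
      · exact Matrix.single_mul_single_of_ne _ _ _ _ e _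
    | direct p =>
      refine Matrix.single_mul_single_of_ne _ _ _ _ (fun e => ?_) _
      rw [nxt_injective e, D.get_y] at hl
      cases hl
  have h2 (j) : letterEntry k R (D.t.get j) j (nxt j) (κ' j) *
      κ D.x • Matrix.single D.y (nxt D.x) (pathElem k R D.fR) =
        if j = D.y then D.longMatrix k κ else 0 := by
    rw [Matrix.mul_smul]
    split_ifs with e
    · rw [e, D.get_y, h, letterEntry, Matrix.single_mul_single_same, longMatrix, one_smul,
        pathElem_append k _ D.fR]
    generalize hl : D.t.get j = l
    cases l with
    | inverse p => rw [letterEntry, Matrix.single_mul_single_of_ne _ _ _ _ e, smul_zero]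
    | direct p =>
      by_cases e' : nxt j = D.y
      · have := D.ht.junction j
        rw [e', hl, D.get_y] at this
        rw [e', letterEntry, Matrix.single_mul_single_same, smul_mul_assoc,
          pathElem_mul_eq_zero_of_junction_left k hR D.f_ne_nil D.fR_ne_nil D.isPath_f_fR this,
          smul_zero, Matrix.single_zero, smul_zero]
      · rw [letterEntry, Matrix.single_mul_single_of_ne _ _ _ _ e', smul_zero]
  simp only [shear, weightedMatrix, Matrix.mul_add, Matrix.sum_mul, h1, h2,
    Finset.sum_const_zero, add_zero, Finset.sum_ite_eq', Finset.mem_univ, if_true]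

/-- The corrections `F H` and `H F` remove precisely the letters at `D.x` and `D.y`; all remaining
entries are letters of the cone, where an inverted letter read in reverse gives the same matrix
entry. -/
theorem weightedMatrix_letter (h : κ' D.y = 1) :
    weightedMatrix k R D.letter D.next (D.weight k κ κ') =
      Matrix.fromBlocks (-weightedMatrix k R D.s.get nxt κ + D.mapMatrix k * D.shear k κ)
        (D.mapMatrix k) (D.longMatrix k κ)
        (weightedMatrix k R D.t.get nxt κ' - D.shear k κ * D.mapMatrix k) := by
  have hl (i) : letterEntry k R (D.letter (.inl i)) (.inl i) (D.next (.inl i))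
      (D.weight k κ κ' (.inl i)) = Matrix.fromBlocks
        (-letterEntry k R (D.s.get i) i (nxt i) (κ i) +
          if i = D.x then D.mapMatrix k * D.shear k κ else 0)
        (if i = D.x then D.mapMatrix k else 0) 0 0 := by
    by_cases e : i = D.x
    · subst e
      rw [if_pos rfl, if_pos rfl, letter_inl_x, next_inl_x, D.get_x, mapMatrix_mul_shear, weight,
        if_pos rfl, mapMatrix, letterEntry, letterEntry, Matrix.smul_single, neg_add_cancel,
        one_smul]
      ext (a | a) (b | b) <;> simp [Matrix.single_apply]
    · rw [if_neg e, if_neg e, D.letter_inl e, D.next_inl e, weight, if_neg e, letterEntry_neg,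
        add_zero]
      ext (a | a) (b | b) <;> cases D.s.get i <;> simp [letterEntry, Matrix.single_apply]
  have hr (j) : letterEntry k R (D.letter (.inr (nxt j))) (.inr (nxt j)) (D.next (.inr (nxt j)))
      (D.weight k κ κ' (.inr (nxt j))) = Matrix.fromBlocks 0 0
        (if j = D.y then D.longMatrix k κ else 0)
        (letterEntry k R (D.t.get j) j (nxt j) (κ' j) -
          if j = D.y then D.shear k κ * D.mapMatrix k else 0) := by
    by_cases e : j = D.y
    · subst e
      rw [if_pos rfl, if_pos rfl, letter_inr_nxt_y, next_inr_nxt_y, D.get_y, shear_mul_mapMatrix,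
        weight, if_pos rfl, longMatrix, letterEntry, letterEntry, h, one_smul, sub_self,
        Matrix.smul_single]
      ext (a | a) (b | b) <;> simp [Matrix.single_apply]
    · rw [if_neg e, if_neg e, D.letter_inr_nxt e, D.next_inr_nxt e, D.weight_inr_nxt k κ κ' e,
        letterEntry_bar, sub_zero]
      ext (a | a) (b | b) <;> cases D.t.get j <;> simp [letterEntry, Matrix.single_apply]
  rw [weightedMatrix, Fintype.sum_sum_type, ← Equiv.sum_comp (nxtEquiv D.t.length)]
  simp only [nxtEquiv_apply, hl, hr, fromBlocks_sum, Matrix.fromBlocks_add, weightedMatrix,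
    Finset.sum_add_distrib, Finset.sum_sub_distrib, Finset.sum_neg_distrib, Finset.sum_ite_eq',
    Finset.mem_univ, if_true, Finset.sum_const_zero, add_zero, zero_add]

/-- After a base change the differential of the cone is given by the letters of the cone. -/
theorem coneMatrix_mul (hR : IsGentle R) (h : κ' D.y = 1) :
    Matrix.fromBlocks (-weightedMatrix k R D.s.get nxt κ) (D.mapMatrix k) 0
        (weightedMatrix k R D.t.get nxt κ') * Matrix.fromBlocks 1 0 (D.shear k κ) 1 =
      Matrix.fromBlocks 1 0 (D.shear k κ) 1 *
        weightedMatrix k R D.letter D.next (D.weight k κ κ') := by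
  rw [D.weightedMatrix_letter k κ κ' h, Matrix.fromBlocks_multiply, Matrix.fromBlocks_multiply]
  simp only [add_zero, zero_add, Matrix.mul_one,
    Matrix.one_mul, Matrix.mul_zero, Matrix.zero_mul, Matrix.mul_add, Matrix.mul_neg,
    ← Matrix.mul_assoc, D.shear_mul_weightedMatrix k κ hR, D.weightedMatrix_mul_shear k κ κ' hR h,
    shear_mul_mapMatrix_mul_shear, neg_add_cancel, add_sub_cancel]

end ConeData

end ConeMatrix

/-! ### Module maps given by matrices acting on row vectors -/

section RowMaps

variable {A : Type w} [Ring A] {J₁ J₂ J₃ : Type} [Fintype J₁]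
  {X : Submodule A (J₁ → A)} {Y : Submodule A (J₂ → A)} {Z : Submodule A (J₃ → A)}

/-- The map between modules of row vectors given by a matrix. -/
noncomputable def rowMap (X : Submodule A (J₁ → A)) (Y : Submodule A (J₂ → A)) (M : Matrix J₁ J₂ A)
    (h : ∀ z ∈ X, Matrix.vecMulLinear M z ∈ Y) :
    ModuleCat.of A X ⟶ ModuleCat.of A Y :=
  ModuleCat.ofHom ((Matrix.vecMulLinear M).restrict h)

theorem rowMap_ext {f : ModuleCat.of A X ⟶ ModuleCat.of A Y} {M : Matrix J₁ J₂ A}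
    {h : ∀ z ∈ X, Matrix.vecMulLinear M z ∈ Y}
    (hf : ∀ z : X, (f.hom z : Y).1 = Matrix.vecMul z.1 M) : f = rowMap X Y M h :=
  ModuleCat.hom_ext (LinearMap.ext fun z => Subtype.ext (hf z))

theorem rowMap_congr {M N : Matrix J₁ J₂ A} (e : M = N)
    (h : ∀ z ∈ X, Matrix.vecMulLinear M z ∈ Y) (h' : ∀ z ∈ X, Matrix.vecMulLinear N z ∈ Y) :
    rowMap X Y M h = rowMap X Y N h' := by
  subst e
  rfl

theorem mul_mem_of_mem [Fintype J₂] {M : Matrix J₁ J₂ A} {N : Matrix J₂ J₃ A}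
    (h : ∀ z ∈ X, Matrix.vecMulLinear M z ∈ Y) (h' : ∀ z ∈ Y, Matrix.vecMulLinear N z ∈ Z) :
    ∀ z ∈ X, Matrix.vecMulLinear (M * N) z ∈ Z := by
  intro z hz
  have := h' _ (h z hz)
  rwa [Matrix.vecMulLinear_apply, Matrix.vecMulLinear_apply, Matrix.vecMul_vecMul] at this

theorem add_mem_of_mem {M N : Matrix J₁ J₂ A}
    (h : ∀ z ∈ X, Matrix.vecMulLinear M z ∈ Y) (h' : ∀ z ∈ X, Matrix.vecMulLinear N z ∈ Y) :
    ∀ z ∈ X, Matrix.vecMulLinear (M + N) z ∈ Y := by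
  intro z hz
  have := Y.add_mem (h z hz) (h' z hz)
  rwa [Matrix.vecMulLinear_apply, Matrix.vecMulLinear_apply, ← Matrix.vecMul_add] at this

theorem rowMap_comp [Fintype J₂] {M : Matrix J₁ J₂ A} {N : Matrix J₂ J₃ A}
    (h : ∀ z ∈ X, Matrix.vecMulLinear M z ∈ Y) (h' : ∀ z ∈ Y, Matrix.vecMulLinear N z ∈ Z) :
    rowMap X Y M h ≫ rowMap Y Z N h' = rowMap X Z (M * N) (mul_mem_of_mem h h') :=
  rowMap_ext fun z => Matrix.vecMul_vecMul z.1 M N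

theorem rowMap_add {M N : Matrix J₁ J₂ A}
    (h : ∀ z ∈ X, Matrix.vecMulLinear M z ∈ Y) (h' : ∀ z ∈ X, Matrix.vecMulLinear N z ∈ Y) :
    rowMap X Y M h + rowMap X Y N h' = rowMap X Y (M + N) (add_mem_of_mem h h') :=
  rowMap_ext fun z => (Matrix.vecMul_add M N z.1).symm

theorem rowMap_eq_zero {M : Matrix J₁ J₂ A} (h : ∀ z ∈ X, Matrix.vecMulLinear M z ∈ Y)
    (e : M = 0) : rowMap X Y M h = 0 := by
  subst e
  exact (rowMap_ext fun z => (Matrix.vecMul_zero z.1).symm).symm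

theorem rowMap_eq_id [DecidableEq J₁] {M : Matrix J₁ J₁ A}
    (h : ∀ z ∈ X, Matrix.vecMulLinear M z ∈ X) (e : M = 1) : rowMap X X M h = 𝟙 _ := by
  subst e
  exact (rowMap_ext fun z => (Matrix.vecMul_one z.1).symm).symm

end RowMaps

/-! ### From invertible matrices to an isomorphism with the mapping cone -/

section ConeIso

variable (k : Type w) [Field k] {Q : Type u} [Quiver.{v} Q] [Fintype Q]
  {R : Quiver.Total Q → Quiver.Total Q → Prop}

theorem bandComplex_d {c : List (Letter Q)} (hw : IsCyclicString R c) (lam : k)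
    (m : Fin c.length) (d n n' : ℤ) (hn : n + 1 = n') :
    (bandComplex k hw lam m d).d n n' = rowMap (bandX k hw d n) (bandX k hw d n')
      (bandMatrix k R c lam m) (vecMul_bandMatrix_mem k hw lam m d n n' hn) :=
  dif_pos hn

/-- A matrix defines maps of degree `e` between graded modules of row vectors. -/
def IsHomogeneous {s t : List (Letter Q)} (hs : IsCyclicString R s) (ht : IsCyclicString R t)
    (d d' : ℤ) (M : Matrix (Fin s.length) (Fin t.length) (Alg k R)) (e : ℤ) : Prop :=
  ∀ i j, M i j = 0 ∨ (nodeDeg t d' j = nodeDeg s d i + e ∧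
    ∀ z ∈ proj k R (nodeVtx hs i), z * M i j ∈ proj k R (nodeVtx ht j))

variable {k} in
theorem IsHomogeneous.vecMul_mem {s t : List (Letter Q)} {hs : IsCyclicString R s}
    {ht : IsCyclicString R t} {d d' : ℤ} {M : Matrix (Fin s.length) (Fin t.length) (Alg k R)}
    {e : ℤ} (h : IsHomogeneous k hs ht d d' M e) {n n' : ℤ} (hn : n + e = n') :
    ∀ z ∈ bandX k hs d n, Matrix.vecMulLinear M z ∈ bandX k ht d' n' := by
  intro z hz j _
  change ∑ i, z i * M i j ∈ _
  refine Submodule.sum_mem _ fun i _ => ?_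
  have hi : z i ∈ if nodeDeg s d i = n then proj k R (nodeVtx hs i) else ⊥ :=
    hz i (Set.mem_univ i)
  rcases h i j with h0 | ⟨hd, hm⟩
  · rw [h0, mul_zero]
    exact Submodule.zero_mem _
  · by_cases hin : nodeDeg s d i = n
    · rw [if_pos hin] at hi
      dsimp only
      rw [hd, hin, if_pos hn]
      exact hm _ hi
    · rw [if_neg hin, Submodule.mem_bot] at hi
      rw [hi, zero_mul]
      exact Submodule.zero_mem _

open CochainComplex HomComplex in
/-- Invertible matrices identify the mapping cone of a map of band complexes given by a matrix
`F`. -/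
theorem nonempty_mappingCone_iso {s t c : List (Letter Q)} {hs : IsCyclicString R s}
    {ht : IsCyclicString R t} {hc : IsCyclicString R c} {lam mu nu : k} {m : Fin s.length}
    {m' : Fin t.length} {m'' : Fin c.length} {d d' d'' : ℤ}
    (φ : bandComplex k hs lam m d ⟶ bandComplex k ht mu m' d')
    {F : Matrix (Fin s.length) (Fin t.length) (Alg k R)}
    (hF : ∀ (n : ℤ) (z : bandX k hs d n),
      ((φ.f n).hom z : bandX k ht d' n).1 = Matrix.vecMul z.1 F)
    {A : Matrix (Fin s.length) (Fin c.length) (Alg k R)}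
    {B : Matrix (Fin t.length) (Fin c.length) (Alg k R)}
    {A' : Matrix (Fin c.length) (Fin s.length) (Alg k R)}
    {B' : Matrix (Fin c.length) (Fin t.length) (Alg k R)}
    (hA : IsHomogeneous k hs hc d d'' A (-1)) (hB : IsHomogeneous k ht hc d' d'' B 0)
    (hA' : IsHomogeneous k hc hs d'' d A' 1) (hB' : IsHomogeneous k hc ht d'' d' B' 0)
    (hAA' : A * A' = 1) (hAB' : A * B' = 0) (hBA' : B * A' = 0) (hBB' : B * B' = 1)
    (hinv : A' * A + B' * B = 1)
    (hdA : A * bandMatrix k R c nu m'' + bandMatrix k R s lam m * A = F * B)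
    (hdB : bandMatrix k R t mu m' * B = B * bandMatrix k R c nu m'') :
    Nonempty (mappingCone φ ≅ bandComplex k hc nu m'' d'') := by
  let α : Cochain (bandComplex k hs lam m d) (bandComplex k hc nu m'' d'') (-1) :=
    Cochain.mk fun p q hpq => rowMap (bandX k hs d p) (bandX k hc d'' q) A (hA.vecMul_mem hpq)
  let β : bandComplex k ht mu m' d' ⟶ bandComplex k hc nu m'' d'' :=
    { f n := rowMap (bandX k ht d' n) (bandX k hc d'' n) B (hB.vecMul_mem (add_zero n))
      comm' := by
        intro n n' hn
        rw [bandComplex_d k hc _ _ _ n n' hn, bandComplex_d k ht _ _ _ n n' hn]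
        refine (rowMap_comp _ _).trans (Eq.trans ?_ (rowMap_comp _ _).symm)
        exact rowMap_congr hdB.symm _ _ }
  have hφ : ∀ n, ∃ h, φ.f n = rowMap (bandX k hs d n) (bandX k ht d' n) F h := by
    intro n
    have h : ∀ z ∈ bandX k hs d n, Matrix.vecMulLinear F z ∈ bandX k ht d' n := by
      intro z hz
      have := ((φ.f n).hom (⟨z, hz⟩ : bandX k hs d n) : bandX k ht d' n).2
      rwa [hF n ⟨z, hz⟩] at this
    exact ⟨h, rowMap_ext (hF n)⟩
  have eq : δ (-1) 0 α = Cochain.ofHom (φ ≫ β) := by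
    refine Cochain.ext₀ _ _ fun p => ?_
    -- The sign in the coboundary of a cochain of degree -1 is `(-1)^0`, so both terms are added, as
    -- in `hdA`. The sign of the shifted differential is hidden in that rearrangement.
    rw [δ_v (-1) 0 (neg_add_cancel 1) α p p (add_zero p) (p - 1) (p + 1) rfl rfl]
    obtain ⟨h, e⟩ := hφ p
    rw [Cochain.ofHom_v, HomologicalComplex.comp_f, e, Int.negOnePow_zero, one_smul,
      bandComplex_d k hc _ _ _ (p - 1) p (by lia), bandComplex_d k hs _ _ _ p (p + 1) rfl]
    refine Eq.trans (congrArg₂ (· + ·) (rowMap_comp _ _) (rowMap_comp _ _)) ?_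
    refine (rowMap_add _ _).trans (Eq.trans ?_ (rowMap_comp _ _).symm)
    exact rowMap_congr hdA _ _
  let ψ := mappingCone.desc φ α β eq
  have hψ : ∀ n, IsIso (ψ.f n) := by
    intro n
    let a : (bandComplex k hc nu m'' d'').X n ⟶ (bandComplex k hs lam m d).X (n + 1) :=
      rowMap (bandX k hc d'' n) (bandX k hs d (n + 1)) A' (hA'.vecMul_mem rfl)
    let b : (bandComplex k hc nu m'' d'').X n ⟶ (bandComplex k ht mu m' d').X n :=
      rowMap (bandX k hc d'' n) (bandX k ht d' n) B' (hB'.vecMul_mem (add_zero n))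
    -- The inverse is needed only degreewise: a chain map whose components are invertible is an
    -- isomorphism, so `A'` and `B'` need not be checked against the differentials.
    let g := a ≫ (mappingCone.inl φ).v (n + 1) n (by lia) + b ≫ (mappingCone.inr φ).f n
    have h1 : α.v (n + 1) n (by lia) ≫ a = 𝟙 _ := (rowMap_comp _ _).trans (rowMap_eq_id _ hAA')
    have h2 : α.v (n + 1) n (by lia) ≫ b = 0 := (rowMap_comp _ _).trans (rowMap_eq_zero _ hAB')
    have h3 : β.f n ≫ a = 0 := (rowMap_comp _ _).trans (rowMap_eq_zero _ hBA')
    have h4 : β.f n ≫ b = 𝟙 _ := (rowMap_comp _ _).trans (rowMap_eq_id _ hBB')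
    have h5 : a ≫ α.v (n + 1) n (by lia) + b ≫ β.f n = 𝟙 _ :=
      (congrArg₂ (· + ·) (rowMap_comp _ _) (rowMap_comp _ _)).trans
        ((rowMap_add _ _).trans (rowMap_eq_id _ hinv))
    refine ⟨g, ?_, ?_⟩
    · refine mappingCone.ext_from φ (n + 1) n rfl ?_ ?_
      · rw [mappingCone.inl_v_desc_f_assoc, Preadditive.comp_add, reassoc_of% h1, reassoc_of% h2,
          Limits.zero_comp, add_zero, Category.comp_id]
      · rw [mappingCone.inr_f_desc_f_assoc, Preadditive.comp_add, reassoc_of% h3, reassoc_of% h4,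
          Limits.zero_comp, zero_add, Category.comp_id]
    · rw [Preadditive.add_comp, Category.assoc, Category.assoc, mappingCone.inl_v_desc_f,
        mappingCone.inr_f_desc_f, h5]
  have := HomologicalComplex.Hom.isIso_of_components ψ
  exact ⟨asIso ψ⟩

end ConeIso

/-! ### Words that spell out the letters of the cone -/

section ReadingWords

variable {Q : Type u} [Quiver.{v} Q] {R : Quiver.Total Q → Quiver.Total Q → Prop}

namespace ConeData

variable (D : ConeData R)

/-- A word which, read cyclically, consists of the letters of the cone. -/
structure IsWord (c : List (Letter Q)) (e : Fin c.length ≃ D.Node) : Prop where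
  get_eq : ∀ i, c.get i = D.letter (e i)
  nxt_eq : ∀ i, e (nxt i) = D.next (e i)
  first : ∀ i, i.1 = 0 → ∃ j, e i = .inl j ∧ j.1 = 0
  balanced : c.countP (fun l => l.isDirect) = c.countP (fun l => !l.isDirect)

namespace IsWord

variable {D} {c : List (Letter Q)} {e : Fin c.length ≃ D.Node}

theorem isCyclicString (h : D.IsWord c e) : IsCyclicString R c where
  ne_nil := List.ne_nil_of_length_pos (Nat.zero_lt_of_lt (e.symm (.inl D.x)).2)
  isPath l hl := by
    obtain ⟨i, rfl⟩ := List.get_of_mem hl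
    exact h.get_eq i ▸ D.isPath_letter (e i)
  junction i := by
    rw [h.get_eq, h.get_eq, h.nxt_eq]
    exact D.junction_letter (e i)
  balanced := h.balanced

theorem nodeVtx_eq (h : D.IsWord c e) (hc : IsCyclicString R c) (i : Fin c.length) :
    nodeVtx hc i = D.vertex (e i) :=
  (leftEnd_eq_of_eq (h.get_eq i) _ (D.isPath_letter (e i)).1).trans (D.leftEnd_letter (e i))

theorem nodeDeg_eq (h : D.IsWord c e) {d d' : ℤ}
    (hd : nodeDeg D.s d D.x = nodeDeg D.t d' D.y) (i : Fin c.length) :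
    nodeDeg c (d - 1) i = D.degree d d' (e i) := by
  obtain ⟨i, hi⟩ := i
  -- The field `first` fixes the degree at the leftmost node, which is that of `σ` and hence shifted
  -- by one. The remaining degrees are forced by the signs of the letters.
  induction i with
  | zero =>
    obtain ⟨j, hj, h0⟩ := h.first ⟨0, hi⟩ rfl
    rw [hj]
    simp [degree, h0, nodeDeg]
  | succ i ih =>
    have hi' : i < c.length := by omega
    have e1 : (⟨i + 1, hi⟩ : Fin c.length) = nxt ⟨i, hi'⟩ :=
      Fin.ext (Nat.mod_eq_of_lt hi).symm
    rw [e1, h.nxt_eq, D.degree_next hd, nodeDeg_nxt h.isCyclicString, ih hi', h.get_eq]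

end IsWord

end ConeData

end ReadingWords

/-! ### Homogeneity of the base change, and the isomorphism -/

section Assembly

variable (k : Type w) [Field k] {Q : Type u} [Quiver.{v} Q] [Fintype Q]
  {R : Quiver.Total Q → Quiver.Total Q → Prop}

namespace ConeData

variable (D : ConeData R)

theorem mul_fR_mem (z : Alg k R) (c : k) :
    z * (c • pathElem k R D.fR) ∈ proj k R (nodeVtx D.hs (nxt D.x)) := by
  rw [nodeVtx_nxt D.hs D.x _ D.get_x (by simp [D.f_ne_nil]),
    List.getLast_append_of_ne_nil _ D.fR_ne_nil]
  exact mul_mem_proj k z c _ D.fR_ne_nil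

theorem mul_fL_mem (z : Alg k R) (c : k) :
    z * (c • pathElem k R D.fL) ∈ proj k R (nodeVtx D.hs D.x) := by
  have e : nodeVtx D.hs D.x = (D.fL.getLast D.fL_ne_nil).left := by
    refine (leftEnd_eq_of_eq D.get_x _ (by simp [Letter.path, D.f_ne_nil])).trans ?_
    refine (leftEnd_direct_of_head _ D.f_ne_nil (List.head?_append_of_ne_nil _ D.f_ne_nil)).trans ?_
    -- The vertex at `D.x` is where `f` ends, and `f_L` starts there because `f_L f` is a path.
    exact ((List.isChain_append.1 D.isPath_fL_f.2).2.2 _ (List.getLast?_eq_some_getLast _) _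
      (List.head?_eq_some_head _)).1.symm
  rw [e]
  exact mul_mem_proj k z c _ D.fL_ne_nil

/-- The base change matrix. -/
noncomputable def baseChange (κ : Fin D.s.length → k) (ε : k) :
    Matrix D.Node D.Node (Alg k R) :=
  Matrix.fromBlocks 1 0 (ε • D.shear k κ) 1

theorem baseChange_mul (κ : Fin D.s.length → k) {ε ε' : k} (h : ε + ε' = 0) :
    D.baseChange k κ ε * D.baseChange k κ ε' = 1 := by
  rw [baseChange, baseChange, Matrix.fromBlocks_multiply, ← Matrix.fromBlocks_one]
  simp only [Matrix.mul_one, Matrix.one_mul, Matrix.mul_zero, Matrix.zero_mul, add_zero, zero_add,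
    ← add_smul, h, zero_smul]

/-- Both entries of `H` lower the unshifted degree by -1, that is, raise it by one, so they have
degree 0 once the nodes of `σ` are shifted. This lets the base change act degree by degree. -/
theorem shear_homogeneous {d d' : ℤ} (h : nodeDeg D.s d D.x = nodeDeg D.t d' D.y)
    (κ : Fin D.s.length → k) (ε : k) (j : Fin D.t.length) (i : Fin D.s.length) :
    (ε • D.shear k κ) j i = 0 ∨ (nodeDeg D.s d i - 1 = nodeDeg D.t d' j ∧
      ∀ z, z * (ε • D.shear k κ) j i ∈ proj k R (nodeVtx D.hs i)) := by
  have hx := nodeDeg_nxt D.hs d D.x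
  have hy := nodeDeg_nxt D.ht d' D.y
  rw [D.get_x] at hx
  rw [D.get_y] at hy
  simp only [Letter.sgn] at hx hy
  by_cases h1 : D.y = j ∧ nxt D.x = i
  · obtain ⟨rfl, rfl⟩ := h1
    refine Or.inr ⟨by linarith, fun z => ?_⟩
    have : (ε • D.shear k κ) D.y (nxt D.x) = (ε * κ D.x) • pathElem k R D.fR := by
      simp [shear, D.ht.nxt_ne D.y, mul_smul]
    rw [this]
    exact D.mul_fR_mem k z _
  by_cases h2 : nxt D.y = j ∧ D.x = i
  · obtain ⟨rfl, rfl⟩ := h2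
    refine Or.inr ⟨by linarith, fun z => ?_⟩
    have : (ε • D.shear k κ) (nxt D.y) D.x = ε • pathElem k R D.fL := by
      simp [shear, D.hs.nxt_ne D.x]
    rw [this]
    exact D.mul_fL_mem k z _
  · left
    simp only [shear, Matrix.smul_apply, Matrix.add_apply, Matrix.single_apply, if_neg h1,
      if_neg h2, smul_zero, add_zero]

theorem baseChange_homogeneous {d d' : ℤ} (h : nodeDeg D.s d D.x = nodeDeg D.t d' D.y)
    (κ : Fin D.s.length → k) (ε : k) (a b : D.Node) :
    D.baseChange k κ ε a b = 0 ∨ (D.degree d d' b = D.degree d d' a ∧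
      ∀ z ∈ proj k R (D.vertex a), z * D.baseChange k κ ε a b ∈ proj k R (D.vertex b)) := by
  have one : ∀ a, D.baseChange k κ ε a a = 1 := by
    rintro (a | a) <;> simp [baseChange]
  by_cases e : a = b
  · subst e
    right
    simp [one]
  rcases a with a | a <;> rcases b with b | b
  · left
    exact Matrix.one_apply_ne (fun h => e (congrArg _ h))
  · exact Or.inl rfl
  · exact (D.shear_homogeneous k h κ ε a b).imp id fun ⟨h₁, h₂⟩ => ⟨h₁, fun z _ => h₂ z⟩
  · left
    exact Matrix.one_apply_ne (fun h => e (congrArg _ h))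

namespace IsWord

variable {D} {c : List (Letter Q)} {e : Fin c.length ≃ D.Node}

variable {k} in
theorem nonempty_iso (h : D.IsWord c e) (hc : IsCyclicString R c) (hR : IsGentle R) {lam mu : k}
    (hlam : lam ≠ 0) (hmu : mu ≠ 0) {m : Fin D.s.length} (hm : (D.s.get m).isDirect = true)
    {m' : Fin D.t.length} (hm' : (D.t.get m').isDirect = true) {d d' : ℤ}
    (φ : bandComplex k D.hs lam m d ⟶ bandComplex k D.ht mu m' d')
    (hφ : IsSingleMap k φ D.f D.x D.y) {m'' : Fin c.length} (hm'' : (c.get m'').isDirect = true) :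
    Nonempty (CochainComplex.mappingCone φ ≅
      bandComplex k hc (-(lam * mu⁻¹)) m'' (d - 1)) := by
  -- The scalar `μ` lies on a direct letter while `τ_R` is inverse, so `τ_R` carries the scalar 1
  -- that the base change requires.
  have hy : m' ≠ D.y := by
    rintro rfl
    rw [D.get_y] at hm'
    exact Bool.false_ne_true hm'
  have hprod : ∀ (w : List (Letter Q)) (m : Fin w.length) (a : k), (w.get m).isDirect = true →
      ∏ i, signedWeight (w.get i) (if i = m then a else 1) = a := by
    intro w m a hm
    rw [Finset.prod_eq_single m]
    · cases hl : w.get m with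
      | direct p => simp [signedWeight]
      | inverse p => rw [hl] at hm; exact absurd hm Bool.false_ne_true
    · intro i _ hi
      cases w.get i <;> simp [signedWeight, hi]
    · simp
  set κ : Fin D.s.length → k := fun i => if i = m then lam else 1 with hκ
  set κ' : Fin D.t.length → k := fun i => if i = m' then mu else 1 with hκ'
  have hκ0 : ∀ i, κ i ≠ 0 := fun i => by simp only [κ]; split_ifs <;> simp [hlam]
  have hκ0' : ∀ i, κ' i ≠ 0 := fun i => by simp only [κ']; split_ifs <;> simp [hmu]
  have hy1 : κ' D.y = 1 := if_neg (Ne.symm hy)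
  obtain ⟨t, ht0, ht⟩ := exists_diagonal k R c
    (κ := D.weight k κ κ' ∘ e) (κ' := fun i => if i = m'' then -(lam * mu⁻¹) else 1)
    (fun i => D.weight_ne_zero hκ0 hκ0' (e i))
    (fun i => by split_ifs <;> simp [hlam, hmu]) (by
      rw [hprod _ _ _ hm'']
      have := D.prod_signedWeight k κ κ' hy1 (hκ0 _)
      rw [hprod _ _ _ hm, hprod _ _ _ hm', ← e.prod_comp] at this
      rw [← this]
      exact Finset.prod_congr rfl fun i _ => by rw [h.get_eq]; rfl)
  rw [← bandMatrix_eq, ← weightedMatrix_submatrix k R (D.weight k κ κ') e h.get_eq h.nxt_eq] at ht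
  set Δ : Matrix (Fin c.length) (Fin c.length) (Alg k R) :=
    Matrix.diagonal (fun j => algebraMap k (Alg k R) (t j)) with hΔ
  set Δ' : Matrix (Fin c.length) (Fin c.length) (Alg k R) :=
    Matrix.diagonal (fun j => algebraMap k (Alg k R) (t j)⁻¹) with hΔ'
  have hΔΔ' : Δ * Δ' = 1 := by
    rw [hΔ, hΔ', Matrix.diagonal_mul_diagonal, ← Matrix.diagonal_one]
    congr 1
    ext j
    rw [← map_mul, mul_inv_cancel₀ (ht0 j), map_one]
  have hΔ'Δ : Δ' * Δ = 1 := by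
    rw [hΔ, hΔ', Matrix.diagonal_mul_diagonal, ← Matrix.diagonal_one]
    congr 1
    ext j
    rw [← map_mul, inv_mul_cancel₀ (ht0 j), map_one]
  -- The full change of coordinates: the shear, then relabelling of nodes by positions in `c`, then
  -- the diagonal rescaling that collects all scalars on the letter `m''`.
  set U : Matrix D.Node (Fin c.length) (Alg k R) := (D.baseChange k κ 1).submatrix id e * Δ with hU
  set U' : Matrix (Fin c.length) D.Node (Alg k R) := Δ' * (D.baseChange k κ (-1)).submatrix e id
    with hU'
  have hUU' : U * U' = 1 := by
    rw [hU, hU', Matrix.mul_assoc, ← Matrix.mul_assoc Δ, hΔΔ', Matrix.one_mul,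
      Matrix.submatrix_mul_equiv, D.baseChange_mul k κ (add_neg_cancel 1), Matrix.submatrix_id_id]
  have hU'U : U' * U = 1 := by
    have := Matrix.submatrix_mul_equiv (D.baseChange k κ (-1)) (D.baseChange k κ 1) e
      (Equiv.refl _) e
    rw [D.baseChange_mul k κ (neg_add_cancel 1), Matrix.submatrix_one_equiv, Equiv.coe_refl] at this
    rw [hU, hU', Matrix.mul_assoc, ← Matrix.mul_assoc _ _ Δ, this, Matrix.one_mul, hΔ'Δ]
  have hd : Matrix.fromBlocks (-bandMatrix k R D.s lam m) (D.mapMatrix k) 0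
      (bandMatrix k R D.t mu m') * U = U * bandMatrix k R c (-(lam * mu⁻¹)) m'' := by
    have hcone := D.coneMatrix_mul k κ κ' hR hy1
    rw [← one_smul k (D.shear k κ)] at hcone
    change _ * D.baseChange k κ 1 = D.baseChange k κ 1 * _ at hcone
    have h1 := congrArg (fun M => M.submatrix id e) hcone
    have h2 := Matrix.submatrix_mul_equiv (D.baseChange k κ 1)
      (weightedMatrix k R D.letter D.next (D.weight k κ κ')) id e e
    have h3 := Matrix.submatrix_mul_equiv (Matrix.fromBlocks (-weightedMatrix k R D.s.get nxt κ)
      (D.mapMatrix k) 0 (weightedMatrix k R D.t.get nxt κ')) (D.baseChange k κ 1) id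
      (Equiv.refl _) e
    rw [Equiv.coe_refl, Matrix.submatrix_id_id] at h3
    rw [bandMatrix_eq, bandMatrix_eq k R D.t, hU, ← Matrix.mul_assoc, h3, Matrix.mul_assoc, ← ht,
      ← Matrix.mul_assoc, h2]
    exact congrArg (· * Δ) h1
  have hUr : U = Matrix.fromRows U.toRows₁ U.toRows₂ := (Matrix.fromRows_toRows U).symm
  have hUc : U' = Matrix.fromCols U'.toCols₁ U'.toCols₂ := (Matrix.fromCols_toCols U').symm
  rw [hUr, hUc, Matrix.fromRows_mul_fromCols, ← Matrix.fromBlocks_one,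
    Matrix.fromBlocks_inj] at hUU'
  rw [hUr, hUc, Matrix.fromCols_mul_fromRows] at hU'U
  -- The two row blocks are the two conditions for a map out of the cone: a homotopy on the summand
  -- of `σ` and a chain map on that of `τ`.
  rw [hUr, Matrix.fromBlocks_mul_fromRows, Matrix.fromRows_mul, Matrix.fromRows_inj.eq_iff] at hd
  have hUh : ∀ a j, U a j = 0 ∨ (nodeDeg c (d - 1) j = D.degree d d' a ∧
      ∀ z ∈ proj k R (D.vertex a), z * U a j ∈ proj k R (nodeVtx hc j)) := by
    intro a j
    have e1 : U a j = D.baseChange k κ 1 a (e j) * algebraMap k (Alg k R) (t j) :=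
      Matrix.mul_diagonal _ _ _ _
    rw [e1, h.nodeDeg_eq hφ.1, h.nodeVtx_eq hc]
    refine (D.baseChange_homogeneous k hφ.1 κ 1 a (e j)).imp (fun h0 => by rw [h0, zero_mul])
      fun ⟨h₁, h₂⟩ => ⟨h₁, fun z hz => ?_⟩
    rw [← Algebra.commutes, ← mul_assoc, ← Algebra.commutes, mul_assoc]
    exact Submodule.smul_mem _ _ (h₂ z hz)
  have hUh' : ∀ j a, U' j a = 0 ∨ (D.degree d d' a = nodeDeg c (d - 1) j ∧
      ∀ z ∈ proj k R (nodeVtx hc j), z * U' j a ∈ proj k R (D.vertex a)) := by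
    intro j a
    have e1 : U' j a = algebraMap k (Alg k R) (t j)⁻¹ * D.baseChange k κ (-1) (e j) a :=
      Matrix.diagonal_mul _ _ _ _
    rw [e1, h.nodeDeg_eq hφ.1, h.nodeVtx_eq hc]
    refine (D.baseChange_homogeneous k hφ.1 κ (-1) (e j) a).imp (fun h0 => by rw [h0, mul_zero])
      fun ⟨h₁, h₂⟩ => ⟨h₁, fun z hz => ?_⟩
    rw [← mul_assoc, ← Algebra.commutes, mul_assoc]
    exact Submodule.smul_mem _ _ (h₂ z hz)
  have hF : ∀ (n : ℤ) (z : bandX k D.hs d n),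
      ((φ.f n).hom z : bandX k D.ht d' n).1 = Matrix.vecMul z.1 (D.mapMatrix k) := by
    intro n z
    rw [hφ.2 n z]
    ext j
    by_cases hj : j = D.y
    · subst hj
      simp [mapMatrix, Matrix.vecMul, dotProduct, Matrix.single_apply]
    · simp [mapMatrix, Matrix.vecMul, dotProduct, hj, Ne.symm hj]
  refine nonempty_mappingCone_iso k φ hF (A := U.toRows₁) (B := U.toRows₂) (A' := U'.toCols₁)
    (B' := U'.toCols₂) (fun i j => ?_) (fun i j => ?_) (fun j i => ?_) (fun j i => ?_)
    hUU'.1 hUU'.2.1 hUU'.2.2.1 hUU'.2.2.2 hU'U ?_ ?_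
  · exact (hUh (.inl i) j).imp id fun ⟨h₁, h₂⟩ => ⟨h₁, h₂⟩
  · exact (hUh (.inr i) j).imp id fun ⟨h₁, h₂⟩ => ⟨h₁.trans (add_zero _).symm, h₂⟩
  · exact (hUh' j (.inl i)).imp id fun ⟨h₁, h₂⟩ => ⟨sub_eq_iff_eq_add.1 h₁, h₂⟩
  · exact (hUh' j (.inr i)).imp id fun ⟨h₁, h₂⟩ => ⟨h₁.trans (add_zero _).symm, h₂⟩
  · rw [← hd.1, Matrix.neg_mul]
    abel
  · rw [← hd.2, Matrix.zero_mul, zero_add]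

end IsWord

end ConeData

end Assembly

/-! ### Positions in the word `c` and nodes of the cone -/

section ConeWord

variable {Q : Type u} [Quiver.{v} Q] {R : Quiver.Total Q → Quiver.Total Q → Prop}

@[simp] theorem Letter.isDirect_direct (p : List (Quiver.Total Q)) :
    (Letter.direct p).isDirect = true := rfl

@[simp] theorem Letter.isDirect_inverse (p : List (Quiver.Total Q)) :
    (Letter.inverse p).isDirect = false := rfl

theorem nxt_val {n N : ℕ} (h : n = N) (i : Fin n) :
    (nxt i).1 = if i.1 + 1 = N then 0 else i.1 + 1 := by
  subst h
  have := i.2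
  split_ifs with h
  · simp [nxt, h]
  · exact Nat.mod_eq_of_lt (by omega)

theorem countP_isDirect_barWord (w : List (Letter Q)) :
    (barWord w).countP (fun l => l.isDirect) = w.countP (fun l => !l.isDirect) := by
  simp only [barWord, List.countP_reverse, List.countP_map]
  exact List.countP_congr fun l _ => by simp [Letter.isDirect_bar]

theorem countP_not_isDirect_barWord (w : List (Letter Q)) :
    (barWord w).countP (fun l => !l.isDirect) = w.countP (fun l => l.isDirect) := by
  simp only [barWord, List.countP_reverse, List.countP_map]
  exact List.countP_congr fun l _ => by simp [Letter.isDirect_bar]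

theorem coneWord_length (β α δ γ : List (Letter Q)) (σL τL : Letter Q)
    (fL f fR : List (Quiver.Total Q)) : (coneWord β α δ γ σL τL fL f fR).length =
      β.length + δ.length + γ.length + α.length + 4 := by
  simp [coneWord, barWord]
  omega

theorem get_eq_of_getElem? {ι : Type*} {l l' : List ι} {i : Fin l.length} {j : Fin l'.length}
    (h : l[i.1]? = l'[j.1]?) : l.get i = l'.get j := by
  rw [List.getElem?_eq_getElem i.2, List.getElem?_eq_getElem j.2] at h
  exact Option.some.inj h

theorem get_eq_bar_of_getElem? {l l' : List (Letter Q)} {i : Fin l.length} {j : Fin l'.length}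
    (h : l[i.1]? = l'[j.1]?.map Letter.bar) : l.get i = (l'.get j).bar := by
  rw [List.getElem?_eq_getElem i.2, List.getElem?_eq_getElem j.2] at h
  exact Option.some.inj h

theorem getElem?_barWord {w : List (Letter Q)} {i j : ℕ} (h : i + j + 1 = w.length) :
    (barWord w)[i]? = w[j]?.map Letter.bar := by
  rw [barWord, List.getElem?_reverse' (j := j) (by simpa using h), List.getElem?_map]

theorem length_barWord (w : List (Letter Q)) : (barWord w).length = w.length := by
  simp [barWord]

section Entries

variable (β α δ γ : List (Letter Q)) (σL σR τL τR : Letter Q) (fL f fR : List (Quiver.Total Q))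

theorem coneWord_eq : coneWord β α δ γ σL τL fL f fR =
    (β ++ [σL]) ++ (.direct f :: (barWord (δ ++ [τL]) ++ (barWord γ ++
      (.direct (fL ++ f ++ fR) :: α)))) := by
  simp [coneWord, barWord]

variable {i j : ℕ}

theorem coneWord_getElem?_first (h : i < β.length + 1) :
    (coneWord β α δ γ σL τL fL f fR)[i]? = (β ++ [σL, σR] ++ α)[i]? := by
  rw [coneWord_eq, List.getElem?_append_left (by simp; omega),
    show β ++ [σL, σR] ++ α = (β ++ [σL]) ++ ([σR] ++ α) by simp,
    List.getElem?_append_left (l₁ := β ++ [σL]) (l₂ := [σR] ++ α) (by simp; omega)]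

theorem coneWord_getElem?_short (h : i = β.length + 1) :
    (coneWord β α δ γ σL τL fL f fR)[i]? = some (.direct f) := by
  rw [coneWord_eq, List.getElem?_append_right (by simp [h])]
  simp [h]

/-- The stretch of `c` that reads `δ τ_L` backwards; positions in `c` and in `τ` have constant sum.
-/
theorem coneWord_getElem?_second (h : β.length + 1 < i)
    (hj : i + j = β.length + δ.length + 2) :
    (coneWord β α δ γ σL τL fL f fR)[i]? = ((δ ++ [τL, τR] ++ γ)[j]?).map Letter.bar := by
  obtain ⟨n, rfl⟩ : ∃ n, i = n + 1 + (β ++ [σL]).length := ⟨i - (β.length + 2), by simp; omega⟩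
  rw [List.length_append, List.length_singleton] at hj
  rw [coneWord_eq, List.getElem?_append_right (by omega), Nat.add_sub_cancel,
    List.getElem?_cons_succ, List.getElem?_append_left (by rw [length_barWord]; simp; omega),
    getElem?_barWord (j := j) (by simp; omega),
    show δ ++ [τL, τR] ++ γ = (δ ++ [τL]) ++ ([τR] ++ γ) by simp,
    List.getElem?_append_left (l₁ := δ ++ [τL]) (l₂ := [τR] ++ γ) (by simp; omega)]

/-- The stretch that reads `γ` backwards. The constant sum grows by the length of `τ`, since the
backward reading has passed the left end of `τ` and resumes at its right end. -/
theorem coneWord_getElem?_third (h : β.length + δ.length + 2 < i)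
    (h' : i < β.length + δ.length + γ.length + 3)
    (hj : i + j = β.length + δ.length + 2 + (δ.length + 2 + γ.length)) :
    (coneWord β α δ γ σL τL fL f fR)[i]? = ((δ ++ [τL, τR] ++ γ)[j]?).map Letter.bar := by
  obtain ⟨n, rfl⟩ : ∃ n, i = n + (δ ++ [τL]).length + 1 + (β ++ [σL]).length :=
    ⟨i - (β.length + δ.length + 3), by simp; omega⟩
  simp only [List.length_append, List.length_singleton] at hj h'
  rw [coneWord_eq, List.getElem?_append_right (by omega), Nat.add_sub_cancel,
    List.getElem?_cons_succ, List.getElem?_append_right (by rw [length_barWord]; omega),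
    length_barWord, Nat.add_sub_cancel, List.getElem?_append_left (by rw [length_barWord]; omega),
    getElem?_barWord (j := j - (δ.length + 2)) (by omega),
    List.getElem?_append_right (l₁ := δ ++ [τL, τR]) (by simp; omega)]
  simp

theorem coneWord_getElem?_last (n : ℕ) (h : i = n + (β.length + δ.length + γ.length + 3)) :
    (coneWord β α δ γ σL τL fL f fR)[i]? = (.direct (fL ++ f ++ fR) :: α)[n]? := by
  obtain rfl : i = n + (barWord γ).length + (barWord (δ ++ [τL])).length + 1 +
    (β ++ [σL]).length := by simp [length_barWord, h]; omega
  rw [coneWord_eq, List.getElem?_append_right (by omega), Nat.add_sub_cancel,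
    List.getElem?_cons_succ, List.getElem?_append_right (by omega), Nat.add_sub_cancel,
    List.getElem?_append_right (by omega), Nat.add_sub_cancel]

theorem coneWord_getElem?_fourth (h : β.length + 1 < j)
    (hj : j + (δ.length + 2 + γ.length) = i) :
    (coneWord β α δ γ σL τL fL f fR)[i]? = (β ++ [σL, σR] ++ α)[j]? := by
  rw [coneWord_getElem?_last _ _ _ _ _ _ _ _ _ (j - (β.length + 2) + 1) (by omega),
    List.getElem?_cons_succ, List.getElem?_append_right (by simp; omega)]
  simp

end Entries

/-- The words `β σ_L (f f_R) α` and `δ τ_L (f_L f)⁻¹ γ` as data for the cone. -/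
def coneData (β α δ γ : List (Letter Q)) (σL τL : Letter Q) (fL f fR : List (Quiver.Total Q))
    (hs : IsCyclicString R (β ++ [σL, .direct (f ++ fR)] ++ α))
    (ht : IsCyclicString R (δ ++ [τL, .inverse (fL ++ f)] ++ γ))
    (hfL : fL ≠ []) (hf : f ≠ []) (hfR : fR ≠ []) : ConeData R where
  s := β ++ [σL, .direct (f ++ fR)] ++ α
  t := δ ++ [τL, .inverse (fL ++ f)] ++ γ
  hs := hs
  ht := ht
  x := midPos β σL _ α
  y := midPos δ τL _ γ
  fL := fL
  f := f
  fR := fR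
  fL_ne_nil := hfL
  f_ne_nil := hf
  fR_ne_nil := hfR
  get_x := by simp [midPos]
  get_y := by simp [midPos]

variable (β α δ γ : List (Letter Q)) (σL τL : Letter Q) (fL f fR : List (Quiver.Total Q))
    (hs : IsCyclicString R (β ++ [σL, .direct (f ++ fR)] ++ α))
    (ht : IsCyclicString R (δ ++ [τL, .inverse (fL ++ f)] ++ γ))
    (hfL : fL ≠ []) (hf : f ≠ []) (hfR : fR ≠ [])

/-- The node of the cone at a position of `coneWord`. -/
def coneIndex (i : Fin (coneWord β α δ γ σL τL fL f fR).length) :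
    (coneData β α δ γ σL τL fL f fR hs ht hfL hf hfR).Node :=
  -- The nodes of `τ` run down from `D.y` to 0, then wrap to its last node and run down to `nxt
  -- D.y`. If `γ` is empty, `nxt D.y` is the node 0 and the third range is void. The remaining nodes
  -- of `σ` are displaced by the length of `τ`.
  if h₁ : i.1 < β.length + 2 then .inl ⟨i.1, by simp [coneData]; omega⟩
  else if h₂ : i.1 ≤ β.length + δ.length + 3 then
    .inr ⟨β.length + δ.length + 3 - i.1, by simp [coneData]; omega⟩
  else if h₃ : i.1 < β.length + δ.length + γ.length + 4 then
    .inr ⟨β.length + δ.length + 3 + (δ.length + 2 + γ.length) - i.1, by simp [coneData]; omega⟩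
  else .inl ⟨i.1 - (δ.length + 2 + γ.length), by
    have := i.2.trans_eq (coneWord_length ..)
    simp [coneData]
    omega⟩

theorem coneIndex_injective :
    Function.Injective (coneIndex β α δ γ σL τL fL f fR hs ht hfL hf hfR) := by
  intro i j h
  have hi := i.2.trans_eq (coneWord_length ..)
  have hj := j.2.trans_eq (coneWord_length ..)
  unfold coneIndex at h
  apply Fin.ext
  split_ifs at h <;> simp only [Sum.inl.injEq, Sum.inr.injEq, Fin.mk.injEq] at h <;>
    omega

/-- The positions of `coneWord` correspond to the nodes of the cone. -/
noncomputable def coneEquiv : Fin (coneWord β α δ γ σL τL fL f fR).length ≃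
    (coneData β α δ γ σL τL fL f fR hs ht hfL hf hfR).Node :=
  Equiv.ofBijective (coneIndex β α δ γ σL τL fL f fR hs ht hfL hf hfR)
    ((Fintype.bijective_iff_injective_and_card _).2 ⟨coneIndex_injective .., by
      rw [Fintype.card_sum, Fintype.card_fin, Fintype.card_fin, Fintype.card_fin, coneWord_length]
      simp [coneData]
      omega⟩)

section Index

variable {i : Fin (coneWord β α δ γ σL τL fL f fR).length}

local notation "Dat" => coneData β α δ γ σL τL fL f fR hs ht hfL hf hfR
local notation "idx" => coneIndex β α δ γ σL τL fL f fR hs ht hfL hf hfR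

theorem coneIndex_first {j : Fin (Dat).s.length} (h : i.1 < β.length + 2) (hj : j.1 = i.1) :
    idx i = .inl j := by
  rw [coneIndex, dif_pos h]
  exact congrArg _ (Fin.ext hj.symm)

theorem coneIndex_second {j : Fin (Dat).t.length} (h : β.length + 2 ≤ i.1)
    (hj : j.1 + i.1 = β.length + δ.length + 3) : idx i = .inr j := by
  rw [coneIndex, dif_neg (by omega), dif_pos (by omega)]
  refine congrArg _ (Fin.ext ?_)
  simp only
  omega

theorem coneIndex_third {j : Fin (Dat).t.length} (h : β.length + δ.length + 3 < i.1)
    (h' : i.1 < β.length + δ.length + γ.length + 4)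
    (hj : j.1 + i.1 = β.length + δ.length + 3 + (δ.length + 2 + γ.length)) : idx i = .inr j := by
  rw [coneIndex, dif_neg (by omega), dif_neg (by omega), dif_pos h']
  refine congrArg _ (Fin.ext ?_)
  simp only
  omega

theorem coneIndex_fourth {j : Fin (Dat).s.length} (h : β.length + 2 ≤ j.1)
    (hj : j.1 + (δ.length + 2 + γ.length) = i.1) : idx i = .inl j := by
  rw [coneIndex, dif_neg (by omega), dif_neg (by omega), dif_neg (by omega)]
  refine congrArg _ (Fin.ext ?_)
  simp only
  omega

variable (i) in
/-- Position by position, `coneWord` follows the nodes and letters of the cone. -/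
theorem coneIndex_spec : idx (nxt i) = (Dat).next (idx i) ∧
    (coneWord β α δ γ σL τL fL f fR).get i = (Dat).letter (idx i) := by
  have hi := i.2.trans_eq (coneWord_length ..)
  have hn := nxt_val (coneWord_length β α δ γ σL τL fL f fR) i
  have hS : (Dat).s.length = β.length + 2 + α.length := by simp [coneData]; omega
  have hT : (Dat).t.length = δ.length + 2 + γ.length := by simp [coneData]; omega
  have hx : (Dat).x.1 = β.length + 1 := rfl
  have hy : (Dat).y.1 = δ.length + 1 := rfl
  have hnS := nxt_val hS
  have hnT := nxt_val hT
  -- The long letter needs care at both ends: `nxt D.x` wraps to 0 when `α` is empty, and `nxt D.y`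
  -- wraps to 0 when `γ` is empty.
  have long : i.1 = β.length + δ.length + γ.length + 3 →
      idx (nxt i) = .inl (nxt (Dat).x) ∧ idx i = .inr (nxt (Dat).y) := by
    intro h
    have h1 := hnS (Dat).x
    have h2 := hnT (Dat).y
    constructor
    · split_ifs at h1 hn
      · exact coneIndex_first _ _ _ _ _ _ _ _ _ _ _ _ _ _ (by omega) (by omega)
      · omega
      · omega
      · exact coneIndex_fourth _ _ _ _ _ _ _ _ _ _ _ _ _ _ (by omega) (by omega)
    · split_ifs at h2
      · exact coneIndex_second _ _ _ _ _ _ _ _ _ _ _ _ _ _ (by omega) (by omega)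
      · exact coneIndex_third _ _ _ _ _ _ _ _ _ _ _ _ _ _ (by omega) (by omega) (by omega)
  have hs' (j : Fin (Dat).s.length) (h : idx i = .inl j) (hj : j.1 ≠ (Dat).x.1)
      (hn : idx (nxt i) = .inl (nxt j))
      (hg : (coneWord β α δ γ σL τL fL f fR).get i = (Dat).s.get j) :
      idx (nxt i) = (Dat).next (idx i) ∧
        (coneWord β α δ γ σL τL fL f fR).get i = (Dat).letter (idx i) := by
    have hj' : j ≠ (Dat).x := fun e => hj (congrArg _ e)
    rw [h, (Dat).next_inl hj', (Dat).letter_inl hj']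
    exact ⟨hn, hg⟩
  have ht' (j : Fin (Dat).t.length) (h : idx i = .inr (nxt j)) (hj : j.1 ≠ (Dat).y.1)
      (hn : idx (nxt i) = .inr j)
      (hg : (coneWord β α δ γ σL τL fL f fR).get i = ((Dat).t.get j).bar) :
      idx (nxt i) = (Dat).next (idx i) ∧
        (coneWord β α δ γ σL τL fL f fR).get i = (Dat).letter (idx i) := by
    have hj' : j ≠ (Dat).y := fun e => hj (congrArg _ e)
    rw [h, (Dat).next_inr_nxt hj', (Dat).letter_inr_nxt hj']
    exact ⟨hn, hg⟩
  rcases lt_trichotomy i.1 (β.length + 1) with h1 | h1 | h1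
  · have hj := hnS ⟨i.1, by omega⟩
    rw [if_neg (by simp only; omega)] at hj
    simp only at hj
    rw [if_neg (by omega)] at hn
    refine hs' ⟨i.1, by omega⟩ (coneIndex_first _ _ _ _ _ _ _ _ _ _ _ _ _ _ (by omega) rfl)
      (by simp only; omega) (coneIndex_first _ _ _ _ _ _ _ _ _ _ _ _ _ _ (by omega)
        (by omega)) ?_
    exact get_eq_of_getElem? (coneWord_getElem?_first _ _ _ _ _ _ _ _ _ _ h1)
  · rw [if_neg (by omega)] at hn
    have e1 : idx i = .inl (Dat).x :=
      coneIndex_first _ _ _ _ _ _ _ _ _ _ _ _ _ _ (by omega) (by omega)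
    rw [e1, ConeData.next_inl_x, ConeData.letter_inl_x]
    refine ⟨coneIndex_second _ _ _ _ _ _ _ _ _ _ _ _ _ _ (by omega) (by omega), ?_⟩
    exact (List.getElem_eq_iff _).2 (coneWord_getElem?_short _ _ _ _ _ _ _ _ _ h1)
  rcases lt_trichotomy i.1 (β.length + δ.length + γ.length + 3) with h2 | h2 | h2
  · rw [if_neg (by omega)] at hn
    by_cases h3 : i.1 < β.length + δ.length + 3
    -- One less than the index of the node: traversed backwards, the letter that follows a node of
    -- `τ` is the one on its left.
    · have hj := hnT ⟨β.length + δ.length + 2 - i.1, by omega⟩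
      rw [if_neg (by simp only; omega)] at hj
      simp only at hj
      refine ht' ⟨β.length + δ.length + 2 - i.1, by omega⟩
        (coneIndex_second _ _ _ _ _ _ _ _ _ _ _ _ _ _ (by omega) (by omega))
        (by simp only; omega)
        (coneIndex_second _ _ _ _ _ _ _ _ _ _ _ _ _ _ (by omega) (by simp only; omega)) ?_
      exact get_eq_bar_of_getElem? (coneWord_getElem?_second _ _ _ _ _ _ _ _ _ _ h1
        (by simp only; omega))
    · have hj := hnT ⟨β.length + δ.length + 2 + (δ.length + 2 + γ.length) - i.1, by omega⟩
      simp only at hj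
      refine ht' ⟨β.length + δ.length + 2 + (δ.length + 2 + γ.length) - i.1, by omega⟩ ?_
        (by simp only; omega) (coneIndex_third _ _ _ _ _ _ _ _ _ _ _ _ _ _ (by omega) (by omega)
          (by simp only; omega)) ?_
      · split_ifs at hj
        · exact coneIndex_second _ _ _ _ _ _ _ _ _ _ _ _ _ _ (by omega) (by omega)
        · exact coneIndex_third _ _ _ _ _ _ _ _ _ _ _ _ _ _ (by omega) (by omega) (by omega)
      · exact get_eq_bar_of_getElem? (coneWord_getElem?_third _ _ _ _ _ _ _ _ _ _ (by omega)
          (by omega) (by simp only; omega))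
  · rw [(long h2).1, (long h2).2, ConeData.next_inr_nxt_y, ConeData.letter_inr_nxt_y]
    refine ⟨rfl, ?_⟩
    exact (List.getElem_eq_iff _).2 (coneWord_getElem?_last _ _ _ _ _ _ _ _ _ 0 (by omega))
  · have hj := hnS ⟨i.1 - (δ.length + 2 + γ.length), by omega⟩
    simp only at hj
    refine hs' ⟨i.1 - (δ.length + 2 + γ.length), by omega⟩
      (coneIndex_fourth _ _ _ _ _ _ _ _ _ _ _ _ _ _ (by simp only; omega) (by simp only; omega))
      (by simp only; omega) ?_ ?_
    · split_ifs at hj hn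
      · exact coneIndex_first _ _ _ _ _ _ _ _ _ _ _ _ _ _ (by omega) (by omega)
      · omega
      · omega
      · exact coneIndex_fourth _ _ _ _ _ _ _ _ _ _ _ _ _ _ (by omega) (by omega)
    · exact get_eq_of_getElem? (coneWord_getElem?_fourth _ _ _ _ _ _ _ _ _ _ (by simp only; omega)
        (by simp only; omega))

end Index

theorem coneWord_isWord : (coneData β α δ γ σL τL fL f fR hs ht hfL hf hfR).IsWord
    (coneWord β α δ γ σL τL fL f fR) (coneEquiv β α δ γ σL τL fL f fR hs ht hfL hf hfR) where
  get_eq i := (coneIndex_spec β α δ γ σL τL fL f fR hs ht hfL hf hfR i).2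
  nxt_eq i := (coneIndex_spec β α δ γ σL τL fL f fR hs ht hfL hf hfR i).1
  first i hi := by
    refine ⟨⟨i.1, by simp [coneData]; omega⟩, ?_, hi⟩
    exact dif_pos (by omega)
  balanced := by
    have h1 := hs.balanced
    have h2 := ht.balanced
    -- Reversal exchanges the direct and inverse letters of `τ`, `f` replaces the direct letter
    -- `σ_R`, and the long direct letter replaces the inverse of `τ_R`, also direct.
    cases σL <;> cases τL <;>
    simp [coneWord, List.countP_append, countP_isDirect_barWord, countP_not_isDirect_barWord,
      List.countP_cons, Letter.bar] at h1 h2 ⊢ <;> omega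

end ConeWord

end SingleMapCone

open SingleMapCone
theorem mainTheorem6 {k : Type*} [Field k] [IsAlgClosed k] {Q : Type*} [Quiver Q] [Fintype Q]
    (R : Quiver.Total Q → Quiver.Total Q → Prop) (hR : IsGentle R)
    (β α δ γ : List (Letter Q)) (σL σR τL τR : Letter Q) (fL f fR : List (Quiver.Total Q))
    (hσ : IsHomotopyBand R (β ++ [σL, σR] ++ α)) (hτ : IsHomotopyBand R (δ ++ [τL, τR] ++ γ))
    (hf : IsCompatibleSingleton R σL σR τL τR fL f fR)
    (lam mu : k) (hlam : lam ≠ 0) (hmu : mu ≠ 0)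
    (mσ : Fin (β ++ [σL, σR] ++ α).length) (hmσ : ((β ++ [σL, σR] ++ α).get mσ).isDirect = true)
    (mτ : Fin (δ ++ [τL, τR] ++ γ).length) (hmτ : ((δ ++ [τL, τR] ++ γ).get mτ).isDirect = true)
    (d d' : ℤ)
    (φ : bandComplex k hσ.toIsCyclicString lam mσ d ⟶ bandComplex k hτ.toIsCyclicString mu mτ d')
    (hφ : IsSingleMap k φ f (midPos β σL σR α) (midPos δ τL τR γ)) :
    ∃ hc : IsCyclicString R (coneWord β α δ γ σL τL fL f fR),
      (¬ IsProperPower (coneWord β α δ γ σL τL fL f fR) →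
        IsHomotopyBand R (coneWord β α δ γ σL τL fL f fR)) ∧
      ∀ m : Fin (coneWord β α δ γ σL τL fL f fR).length,
        ((coneWord β α δ γ σL τL fL f fR).get m).isDirect = true →
        Nonempty (CochainComplex.mappingCone φ ≅
          bandComplex k hc (-(lam * mu⁻¹)) m (d - 1)) := by
  obtain ⟨hfp, hfL, hfR, rfl, rfl, -, -⟩ := hf
  have h := coneWord_isWord β α δ γ σL τL fL f fR hσ.toIsCyclicString hτ.toIsCyclicString hfL
    hfp.1 hfR
  have hc := h.isCyclicString
  exact ⟨hc, fun hp => ⟨hc, hp⟩, fun m hm => h.nonempty_iso hc hR hlam hmu hmσ hmτ φ hφ hm⟩
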